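/- Let $p$ be a probability distribution on $\mathbb Z_+=\{0,1,2,\dots\}$. The continuous-time Galton–Watson process with reproduction law $p$ is the pure jump Markov process on $\mathbb Z_+$, absorbed at $\partial=0$, with jump rates $q(0,\cdot)=0$ and $q(x,x+n)=x\,p(n+1)$ for $x\ge 1$, $n\ge -1$. Let $X$ be the pure jump Markov process on $E=\{1,2,\dots\}$ with rates $q(x,y)$, $x,y\in E$, let $\kappa(x)=q(x,0)=p(0)\mathbf 1_{x=1}$, and let $Y$ be $X$ killed at rate $\kappa$: with $\zeta$ exponential of parameter $1$ independent of $X$, $Y_t=X_t$ if $\int_0^t\kappa(X_s)\,ds<\zeta$ and $Y_t=\partial$ otherwise. Assume that $p(0)>0$ and $p(\{2,3,\dots\})>0$, that $p$ admits a first moment $m=\sum_{n\ge 0}n\,p(n)\in(0,1)$, and that there exists $\alpha>p(0)/(1-m)$ such that $\sum_{n\ge 0}n^\alpha p(n)<\infty$. Then, for every starting point $x\in E$ and every $t\ge0$, $Y_t$ has the law at time $t$ of the Galton–Watson process started from $x$ (with $\partial=0$), and Assumption H holds for $(X,\kappa)$ with $V(x)=x^\alpha$, that is: 1. every nonempty compact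 $K\subset E$ is a small set for $X$: there are $t_K>0$, $a_K>0$ and a probability measure $\nu_K$ on $K$ with $\mathbb P_x(X_{t_K}\in A)\ge a_K\,\nu_K(A\cap K)$ for all $x\in K$ and all measurable $A\subset E$; 2. $V:E\to[1,\infty)$ is locally bounded, has relatively compact level sets $\{V\le r\}$, and belongs to the extended domain of the generator of $X$ with image $LV$ (for all $x\in E$, $t>0$: $\mathbb E_x|V(X_t)|<\infty$, $\int_0^t\mathbb E_x|LV(X_s)|\,ds<\infty$ and $\mathbb E_xV(X_t)=V(x)+\mathbb E_x\int_0^tLV(X_s)\,ds$), and there are $\lambda_1>\|\kappa\|_\infty$ and $C\in\mathbb R$ with $LV(x)\le-\lambda_1V(x)+C$ for all $x\in E$; 3. for every nonempty compact $K\subset E$, $$\inf_{t\ge0}\frac{\inf_{x\in K}\mathbb P_x(Y_t\ne\partial)}{\sup_{x\in K}\mathbb P_x(Y_t\ne\partial)}>0.$$ -/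

import Mathlib

open MeasureTheory ProbabilityTheory
open scoped ENNReal NNReal Topology

noncomputable section

/-! ### Markov families, killing, and Assumption H

A process with values in `E` is a family `P : E → Measure Ω` (the law when started from `x`)
together with `X : ℝ → Ω → E`, where only the times `t ≥ 0` matter. -/

section General

variable {Ω E : Type*} [MeasurableSpace Ω] [MeasurableSpace E]

/-- `K` is a small set for `X`: for some time `t > 0`, some `a > 0` and some probability measure
`ν` carried by `K`, `P_x (X_t ∈ A) ≥ a ν (A ∩ K)` for all `x ∈ K` and all measurable `A`. -/
def IsSmallSet (P : E → Measure Ω) (X : ℝ → Ω → E) (K : Set E) : Prop :=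
  ∃ t : ℝ, 0 < t ∧ ∃ a : ℝ, 0 < a ∧ ∃ ν : Measure E, IsProbabilityMeasure ν ∧ ν Kᶜ = 0 ∧
    ∀ x ∈ K, ∀ A : Set E, MeasurableSet A → ENNReal.ofReal a * ν (A ∩ K) ≤ P x {ω | X t ω ∈ A}

/-- `V` belongs to the extended domain of the generator of `X`, in the sense of Meyn and Tweedie,
and the extended generator sends `V` to `U`: for all `x` and `t > 0`,
`E_x |V (X_t)| < ∞`, `∫_0^t E_x |U (X_s)| ds < ∞` and
`E_x V (X_t) = V x + E_x ∫_0^t U (X_s) ds`. -/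
def IsExtendedGenerator (P : E → Measure Ω) (X : ℝ → Ω → E) (V U : E → ℝ) : Prop :=
  Measurable V ∧ Measurable U ∧ ∀ x : E, ∀ t : ℝ, 0 < t →
    Integrable (fun ω => V (X t ω)) (P x) ∧
    (∫⁻ s in Set.Ioc 0 t, ∫⁻ ω, ‖U (X s ω)‖ₑ ∂(P x)) < ∞ ∧
    ∫ ω, V (X t ω) ∂(P x) = V x + ∫ ω, (∫ s in (0 : ℝ)..t, U (X s ω)) ∂(P x)

open Classical in
/-- The process `X` killed at rate `κ`, on the enlarged space `Ω × ℝ` whose second coordinate is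
the exponential variable `ζ`. It equals `X_t` if `∫_0^t κ (X_s) ds < ζ`, and the cemetery point
`none` otherwise. -/
def killed (X : ℝ → Ω → E) (κ : E → ℝ≥0) (t : ℝ) (ω : Ω × ℝ) : Option E :=
  if (∫⁻ s in Set.Ioc 0 t, (κ (X s ω.1) : ℝ≥0∞)) < ENNReal.ofReal ω.2 then some (X t ω.1)
  else none

/-- The law of the killed process started from `x`: the variable `ζ` is exponential with
parameter `1` and independent of `X`. -/
def killedLaw (P : E → Measure Ω) (x : E) : Measure (Ω × ℝ) :=
  (P x).prod (expMeasure 1)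

/-- `P_x (Y_t ≠ ∂)`, where `Y` is `X` killed at rate `κ`. -/
def survivalProb (P : E → Measure Ω) (X : ℝ → Ω → E) (κ : E → ℝ≥0) (t : ℝ) (x : E) : ℝ≥0∞ :=
  killedLaw P x {ω | killed X κ t ω ≠ none}

/-- Assumption H for the process `X` with (bounded measurable) killing rate `κ`, realised by the
Lyapunov function `V`. -/
structure AssumptionH [TopologicalSpace E] [PolishSpace E] [BorelSpace E]
    (P : E → Measure Ω) (X : ℝ → Ω → E) (κ : E → ℝ≥0) (V : E → ℝ) : Prop where
  measurable_rate : Measurable κ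
  bounded_rate : BddAbove (Set.range κ)
  small : ∀ K : Set E, IsCompact K → K.Nonempty → IsSmallSet P X K
  one_le : ∀ x, 1 ≤ V x
  locally_bounded : ∀ x, ∃ W ∈ 𝓝 x, BddAbove (V '' W)
  level_sets : ∀ r : ℝ, IsCompact (closure {x | V x ≤ r})
  drift : ∃ LV : E → ℝ, IsExtendedGenerator P X V LV ∧
    ∃ l C : ℝ, ((⨆ x, κ x : ℝ≥0) : ℝ) < l ∧ ∀ x, LV x ≤ -l * V x + C
  survival : ∀ K : Set E, IsCompact K → K.Nonempty →
    0 < ⨅ t : {t : ℝ // 0 ≤ t},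
      (⨅ x : K, survivalProb P X κ t x) / (⨆ x : K, survivalProb P X κ t x)

end General

/-! ### Pure jump Markov processes with given jump rates

The process with rates `q` waits in `x` for an exponential time with parameter `∑ y, q x y`
and then jumps to `y` with probability proportional to `q x y`. A diagonal rate `q x x` only
produces jumps from `x` to itself, which have no influence on the process. -/

section Jump

variable {E : Type*}

/-- The total jump rate from `x`. -/
def totalRate (q : E → E → ℝ≥0∞) (x : E) : ℝ≥0∞ := ∑' y, q x y

open Classical in
/-- The law of the next state after `x`; a state whose total rate is `0` is absorbing. -/
def jumpPMF (q : E → E → ℝ≥0∞) (x : E) : PMF E :=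
  if h : tsum (q x) ≠ 0 ∧ tsum (q x) ≠ ∞ then PMF.normalize (q x) h.1 h.2 else PMF.pure x

/-- The time of the `n`-th jump, on the space of pairs formed by the embedded chain and a sequence
of exponential variables with parameter `1`. The holding time in `x` is such a variable divided by
the total rate of `x`, and `∞` if `x` is absorbing. -/
def jumpTime (q : E → E → ℝ≥0∞) (n : ℕ) (ω : (ℕ → E) × (ℕ → ℝ)) : ℝ≥0∞ :=
  ∑ k ∈ Finset.range n, ENNReal.ofReal (ω.2 k) / totalRate q (ω.1 k)

/-- The state at time `t`: the state of the embedded chain after the jumps up to time `t`. On the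
event that infinitely many jumps occur up to time `t` the value is irrelevant (the initial
state). -/
def jumpProcess (q : E → E → ℝ≥0∞) (t : ℝ) (ω : (ℕ → E) × (ℕ → ℝ)) : E :=
  ω.1 (sInf {n : ℕ | ENNReal.ofReal t < jumpTime q (n + 1) ω})

variable [MeasurableSpace E] [MeasurableSingletonClass E] [Countable E]

/-- The transition kernel of the embedded jump chain. -/
def jumpKernel (q : E → E → ℝ≥0∞) : Kernel E E :=
  Kernel.ofFunOfCountable fun x => (jumpPMF q x).toMeasure

instance instIsMarkovKernelJumpKernel (q : E → E → ℝ≥0∞) : IsMarkovKernel (jumpKernel q) :=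
  ⟨fun x => by
    change IsProbabilityMeasure (jumpPMF q x).toMeasure
    infer_instance⟩

/-- The law on `ℕ → E` of the embedded jump chain started from `x`. -/
def chainLaw (q : E → E → ℝ≥0∞) (x : E) : Measure (ℕ → E) :=
  Kernel.traj (X := fun _ => E)
    (fun n => (jumpKernel q).comap
      (fun h : (i : Finset.Iic n) → E => h ⟨n, Finset.mem_Iic.2 le_rfl⟩)
      (measurable_pi_apply _)) 0 (fun _ => x)

/-- The law of the jump process started from `x`, on the space of pairs formed by the embedded
chain and an independent sequence of exponential variables with parameter `1`. -/
def jumpLaw (q : E → E → ℝ≥0∞) (x : E) : Measure ((ℕ → E) × (ℕ → ℝ)) :=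
  (chainLaw q x).prod (Measure.infinitePi fun _ : ℕ => expMeasure 1)

end Jump

/-! ### Continuous-time Galton-Watson processes -/

instance instMeasurableSpacePNat : MeasurableSpace ℕ+ := ⊤

instance instDiscreteMeasurableSpacePNat : DiscreteMeasurableSpace ℕ+ := ⟨fun _ => trivial⟩

instance instBorelSpacePNat : BorelSpace ℕ+ := ⟨borel_eq_top_of_discrete.symm⟩

/-- The jump rates of the Galton-Watson process with reproduction law `p`:
`q (x, x + n) = x p (n + 1)` for `x ≥ 1` and `n ≥ -1`, all other rates vanish. -/
def gwRate (p : PMF ℕ) (x y : ℕ) : ℝ≥0∞ :=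
  if 1 ≤ x ∧ x ≤ y + 1 then (x : ℝ≥0∞) * p (y + 1 - x) else 0

/-- The jump rates of the process without killing, on `{1, 2, …}`: the rates of the
Galton-Watson process between positive states. -/
def gwUnkilledRate (p : PMF ℕ) (x y : ℕ+) : ℝ≥0∞ := gwRate p x y

/-- The killing rate: the rate of absorption at `0`. -/
def gwKillingRate (p : PMF ℕ) (x : ℕ+) : ℝ≥0 := (gwRate p x 0).toNNReal

/-- Identifies the cemetery point with the absorbing state `0`. -/
def cemeteryToZero : Option ℕ+ → ℕ
  | none => 0
  | some x => x

end

/-!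
The proof rests on the first-jump equation alone; the Markov property at a fixed time is not needed.
Splitting the pair (embedded chain, exponential variables) at its first entries
(`lintegral_jumpLaw`) shows that the expectations
`E_x [f (X_t) exp (- ∫_0^t κ (X_s) ds); fewer than n jumps up to t]` are the iterates `renewalIter`
of the equation
`u_t x = exp (- r x t) f x + ∫_0^t exp (- r x s) ∑ y, q x y u_{t - s} y ds`, where `r x` is the sum
of the total jump rate and of `κ x` (`lintegral_truncatedValue`). Everything else is derived from
these iterates, with values in `[0, ∞]`, so that monotone convergence replaces integrability.

* Non-explosion. If `V ≥ 1` dominates the jump rates and `L V ≤ c V`, the iterates started from `1`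
  with `f = 0`, which are the probabilities of at least `n` jumps up to time `t`, tend to `0`
  (`tendsto_renewalIter_zero`). For the Galton-Watson rates `V x = x + 1` works.
* Law of the killed process. For the process `X` killed at rate `κ` and for the Galton-Watson
  process with a function vanishing at `0`, the first-jump equations coincide, since the killing
  rate compensates exactly the missing jumps to `0` (`renewalIter_gwUnkilledRate`).
* Extended generator. Dynkin's formula for the process stopped at its `n`-th jump follows by
  induction on `n` (`renewalIter_dynkin`). For a bounded function the stopped part vanishes as
  `n → ∞`; a general nonnegative `V` is reached along the truncations `min V k`, for which the mean
  rates of increase and of decrease both grow with `k` (`NonExplosive.dynkin`).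
* Drift. The relative gain `x ((1 + (k - 1) / x) ^ α - 1)` lies between `α (k - 1)` and `k ^ α - 1`
  and tends to `α (k - 1)`. By dominated convergence `L V ∼ - α (1 - m) V`, and
  `α (1 - m) > p 0 = sup κ` by assumption (`eventually_generator_le`).
* Small sets and survival. The positive states communicate. Positivity of the transition
  probabilities propagates along jumps. For the survival probabilities `S_t`, if `q x z > 0` then
  `S_t x ≥ c S_t z` uniformly in `t`, because `S` decreases in time and the first-jump equation
  bounds `S_t x` from below by the paths that jump to `z` before time `1`
  (`iSup_renewalIter_comparison`).
-/

/-! ### Regeneration at the first jump -/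

section Regeneration

/-- A trajectory with a new initial value put in front. -/
def consSeq {α : Type*} (a : α) (c : ℕ → α) : ℕ → α
  | 0 => a
  | n + 1 => c n

@[simp] theorem consSeq_zero {α : Type*} (a : α) (c : ℕ → α) : consSeq a c 0 = a := rfl

@[simp] theorem consSeq_succ {α : Type*} (a : α) (c : ℕ → α) (n : ℕ) :
    consSeq a c (n + 1) = c n := rfl

theorem measurable_consSeq {α : Type*} [MeasurableSpace α] :
    Measurable (fun z : α × (ℕ → α) => consSeq z.1 z.2) := by
  refine measurable_pi_lambda _ fun n => ?_
  cases n with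
  | zero => exact measurable_fst
  | succ n => exact (measurable_pi_apply n).comp measurable_snd

instance instIsProbabilityMeasureExpOne : IsProbabilityMeasure (expMeasure 1) :=
  isProbabilityMeasure_expMeasure one_pos

theorem infinitePi_map_consSeq {α : Type*} [MeasurableSpace α] (μ : Measure α)
    [IsProbabilityMeasure μ] :
    (μ.prod (Measure.infinitePi fun _ : ℕ => μ)).map (fun z => consSeq z.1 z.2) =
      Measure.infinitePi fun _ : ℕ => μ := by
  classical
  refine Measure.eq_infinitePi _ fun s t ht => ?_
  -- the box is enlarged to one over an initial segment of `ℕ`, with full sides outside `s`, so that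
  -- the zeroth factor can be split off
  set t' : ℕ → Set α := fun i => if i ∈ s then t i else Set.univ with ht'
  have ht'm : ∀ i, MeasurableSet (t' i) := fun i => by
    simp only [ht']; split_ifs
    exacts [ht i, MeasurableSet.univ]
  obtain ⟨N, hN⟩ : ∃ N, s ⊆ Finset.range (N + 1) :=
    ⟨s.sup id, fun i hi => Finset.mem_range.2 (Nat.lt_succ_of_le (Finset.le_sup (f := id) hi))⟩
  have hset : Set.pi (s : Set ℕ) t = Set.pi (Finset.range (N + 1) : Set ℕ) t' := by
    ext x
    simp only [Set.mem_pi, Finset.mem_coe, ht']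
    constructor
    · intro h i _
      split_ifs with his
      exacts [h i his, trivial]
    · intro h i hi
      simpa [hi] using h i (hN hi)
  have hprod : ∏ i ∈ s, μ (t i) = ∏ i ∈ Finset.range (N + 1), μ (t' i) := by
    rw [← Finset.prod_subset hN]
    · exact Finset.prod_congr rfl fun i hi => by simp [ht', hi]
    · intro i _ hi
      simp [ht', hi]
  rw [hset, hprod, Measure.map_apply measurable_consSeq
    (MeasurableSet.pi (Finset.countable_toSet _) fun i _ => ht'm i)]
  have hpre : (fun z : α × (ℕ → α) => consSeq z.1 z.2) ⁻¹'
      (Set.pi (Finset.range (N + 1) : Set ℕ) t') =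
      t' 0 ×ˢ Set.pi (Finset.range N : Set ℕ) (fun i => t' (i + 1)) := by
    ext z
    simp only [Set.mem_preimage, Set.mem_pi, Finset.mem_coe, Finset.mem_range, Set.mem_prod]
    constructor
    · intro h
      exact ⟨h 0 (Nat.succ_pos _), fun i hi => h (i + 1) (by omega)⟩
    · rintro ⟨h0, h⟩ i hi
      cases i with
      | zero => exact h0
      | succ i => exact h i (by omega)
  rw [hpre, Measure.prod_prod, Measure.infinitePi_pi _ fun i _ => ht'm _,
    Finset.prod_range_succ']
  ring

variable {E : Type*} [MeasurableSpace E] [MeasurableSingletonClass E] [Countable E]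

theorem jumpKernel_singleton (q : E → E → ℝ≥0∞) (x y : E) :
    jumpKernel q x {y} = jumpPMF q x y := by
  change (jumpPMF q x).toMeasure {y} = _
  exact PMF.toMeasure_apply_singleton _ _ (measurableSet_singleton y)

instance instIsProbabilityMeasureChainLaw (q : E → E → ℝ≥0∞) (x : E) :
    IsProbabilityMeasure (chainLaw q x) := by
  unfold chainLaw; infer_instance

instance instIsProbabilityMeasureJumpLaw (q : E → E → ℝ≥0∞) (x : E) :
    IsProbabilityMeasure (jumpLaw q x) := by
  unfold jumpLaw; infer_instance

open Classical in
theorem chainLaw_cylinder (q : E → E → ℝ≥0∞) (x : E) (a : ℕ → E) (n : ℕ) :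
    chainLaw q x {c | ∀ i ≤ n, c i = a i} =
      (if a 0 = x then 1 else 0) * ∏ i ∈ Finset.range n, jumpPMF q (a i) (a (i + 1)) := by
  induction n with
  | zero =>
    have h := Kernel.traj_map_frestrictLe_apply (X := fun _ => E)
      (κ := fun n => (jumpKernel q).comap
        (fun h : (i : Finset.Iic n) → E => h ⟨n, Finset.mem_Iic.2 le_rfl⟩)
        (measurable_pi_apply _)) (a := 0) (b := 0) (fun _ => x)
    have h2 := congrArg (fun μ => μ {y | y ⟨0, Finset.mem_Iic.2 le_rfl⟩ = a 0}) h
    have hm : MeasurableSet {y : (i : Finset.Iic 0) → E | y ⟨0, Finset.mem_Iic.2 le_rfl⟩ = a 0} :=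
      (measurableSet_singleton (a 0)).preimage
        (measurable_pi_apply (⟨0, Finset.mem_Iic.2 le_rfl⟩ : Finset.Iic 0))
    rw [Measure.map_apply (Preorder.measurable_frestrictLe 0) hm, Kernel.partialTraj_self,
      Kernel.id_apply, Measure.dirac_apply' _ hm] at h2
    have hs : {c : ℕ → E | ∀ i ≤ 0, c i = a i} = Preorder.frestrictLe (π := fun _ => E) 0 ⁻¹'
        {y | y ⟨0, Finset.mem_Iic.2 le_rfl⟩ = a 0} := by
      ext c; simp
    rw [hs]
    refine h2.trans ?_
    by_cases hx : a 0 = x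
    · simp [hx]
    · simp [hx, Set.indicator, eq_comm]
  | succ n ih =>
    set κ := fun n : ℕ => (jumpKernel q).comap
        (fun h : (i : Finset.Iic n) → E => h ⟨n, Finset.mem_Iic.2 le_rfl⟩)
        (measurable_pi_apply _) with hκ
    have h := Kernel.partialTraj_compProd_eq_map_traj (X := fun _ => E) (κ := κ) (a := 0) (b := n)
      (Nat.zero_le n) (x₀ := fun _ => x)
    rw [← Kernel.traj_map_frestrictLe_apply] at h
    set S : Set ((i : Finset.Iic n) → E) :=
      {(fun i => a i.1 : (i : Finset.Iic n) → E)} with hS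
    have hSm : MeasurableSet S := measurableSet_singleton _
    have h2 := congrArg (fun μ => μ (S ×ˢ {a (n + 1)})) h
    rw [Measure.compProd_apply_prod hSm (measurableSet_singleton _),
      Measure.map_apply ((Preorder.measurable_frestrictLe n).prodMk (measurable_pi_apply _))
        (hSm.prod (measurableSet_singleton _)), hS, lintegral_singleton,
      Measure.map_apply (Preorder.measurable_frestrictLe n) hSm] at h2
    have hs1 : {c : ℕ → E | ∀ i ≤ n + 1, c i = a i} =
        (fun c : ℕ → E => (Preorder.frestrictLe (π := fun _ => E) n c, c (n + 1))) ⁻¹'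
          (S ×ˢ {a (n + 1)}) := by
      ext c
      simp only [Set.mem_ofPred_eq, Set.mem_preimage, Set.mem_prod, hS, Set.mem_singleton_iff,
        funext_iff, Subtype.forall, Finset.mem_Iic, Preorder.frestrictLe_apply]
      constructor
      · intro h; exact ⟨fun i hi => h i (by omega), h _ le_rfl⟩
      · rintro ⟨h1, h2⟩ i hi
        rcases Nat.lt_or_ge n i with h3 | h3
        · obtain rfl : i = n + 1 := by omega
          exact h2
        · exact h1 i h3
    have hs2 : {c : ℕ → E | ∀ i ≤ n, c i = a i} =
        Preorder.frestrictLe (π := fun _ => E) n ⁻¹' S := by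
      ext c
      simp only [Set.mem_ofPred_eq, Set.mem_preimage, hS, Set.mem_singleton_iff,
        funext_iff, Subtype.forall, Finset.mem_Iic, Preorder.frestrictLe_apply]
    rw [Finset.prod_range_succ, ← mul_assoc, ← ih, hs1, hs2]
    refine h2.symm.trans ?_
    rw [mul_comm]
    congr 1
    exact jumpKernel_singleton q _ _

theorem measure_sequence_ext (μ ν : Measure (ℕ → E)) [IsFiniteMeasure μ] [IsFiniteMeasure ν]
    (h : ∀ (a : ℕ → E) (n : ℕ), μ {c | ∀ i ≤ n, c i = a i} = ν {c | ∀ i ≤ n, c i = a i}) :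
    μ = ν := by
  have key : ∀ n, μ.map (Preorder.frestrictLe (π := fun _ => E) n) =
      ν.map (Preorder.frestrictLe (π := fun _ => E) n) := by
    intro n
    refine Measure.ext_of_singleton fun b => ?_
    rw [Measure.map_apply (Preorder.measurable_frestrictLe n) (measurableSet_singleton _),
      Measure.map_apply (Preorder.measurable_frestrictLe n) (measurableSet_singleton _)]
    have hs : Preorder.frestrictLe (π := fun _ => E) n ⁻¹' {b} = {c | ∀ i ≤ n, c i =
        (fun j => b ⟨min j n, Finset.mem_Iic.2 (min_le_right _ _)⟩) i} := by
      ext c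
      simp only [Set.mem_ofPred_eq, Set.mem_preimage, Set.mem_singleton_iff,
        funext_iff, Subtype.forall, Finset.mem_Iic, Preorder.frestrictLe_apply]
      refine forall_congr' fun i => forall_congr' fun hi => ?_
      simp [min_eq_left hi]
    rw [hs, h]
  refine IsProjectiveLimit.unique (P := fun I : Finset ℕ => ν.map I.restrict) ?_ fun I => rfl
  intro I
  have hI : I ⊆ Finset.Iic (I.sup id) := fun i hi => Finset.mem_Iic.2 (Finset.le_sup (f := id) hi)
  have hc : (I.restrict : (ℕ → E) → _) =
      Finset.restrict₂ (π := fun _ => E) hI ∘ Preorder.frestrictLe (I.sup id) := rfl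
  have hm := Finset.measurable_restrict₂ (X := fun _ : ℕ => E) hI
  have hm' := Preorder.measurable_frestrictLe (X := fun _ : ℕ => E) (I.sup id)
  change μ.map I.restrict = ν.map I.restrict
  rw [hc, ← Measure.map_map hm hm', ← Measure.map_map hm hm', key]

/-- The embedded chain restarts after its first step. -/
theorem chainLaw_eq_sum (q : E → E → ℝ≥0∞) (x : E) :
    chainLaw q x = Measure.sum fun y =>
      jumpPMF q x y • (chainLaw q y).map (consSeq x) := by
  classical
  have hm : Measurable (consSeq x) := measurable_consSeq.comp measurable_prodMk_left
  have hmap : ∀ y, IsProbabilityMeasure ((chainLaw q y).map (consSeq x)) := fun y =>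
    Measure.isProbabilityMeasure_map hm.aemeasurable
  have : IsFiniteMeasure (Measure.sum fun y => jumpPMF q x y • (chainLaw q y).map (consSeq x)) := by
    refine ⟨?_⟩
    rw [Measure.sum_apply _ MeasurableSet.univ]
    simp [PMF.tsum_coe]
  refine measure_sequence_ext _ _ fun a n => ?_
  have hms : ∀ n, ∀ a : ℕ → E, MeasurableSet {c : ℕ → E | ∀ i ≤ n, c i = a i} := fun n a => by
    simp only [Set.ofPred_forall]
    exact MeasurableSet.iInter fun i => MeasurableSet.iInter fun _ =>
      (measurableSet_singleton (a i)).preimage (measurable_pi_apply i)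
  rw [Measure.sum_apply _ (hms n a), chainLaw_cylinder]
  simp only [Measure.smul_apply, smul_eq_mul, Measure.map_apply hm (hms n a)]
  cases n with
  | zero =>
    by_cases hx : a 0 = x
    · have : consSeq x ⁻¹' {c | ∀ i ≤ 0, c i = a i} = Set.univ := by ext; simp [hx]
      rw [this]
      simp [hx, PMF.tsum_coe]
    · have : consSeq x ⁻¹' {c | ∀ i ≤ 0, c i = a i} = ∅ := by ext; simp [Ne.symm hx]
      rw [this]
      simp [hx]
  | succ n =>
    by_cases hx : a 0 = x
    · have : consSeq x ⁻¹' {c | ∀ i ≤ n + 1, c i = a i} =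
          {c | ∀ i ≤ n, c i = (fun i => a (i + 1)) i} := by
        ext c
        simp only [Set.mem_preimage, Set.mem_ofPred_eq]
        constructor
        · intro h i hi; exact h (i + 1) (by omega)
        · intro h i hi
          cases i with
          | zero => exact hx.symm
          | succ i => exact h i (by omega)
      simp only [this, chainLaw_cylinder]
      rw [tsum_eq_single (a 1)]
      · simp [hx, Finset.prod_range_succ', mul_comm]
      · intro y hy
        simp [Ne.symm hy]
    · have : consSeq x ⁻¹' {c | ∀ i ≤ n + 1, c i = a i} = ∅ := by
        ext c
        simp only [Set.mem_preimage, Set.mem_ofPred_eq, Set.mem_empty_iff_false, iff_false]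
        intro h
        exact hx (h 0 (by omega)).symm
      simp [this, hx]

/-- First-jump decomposition: the process splits into the first exponential variable, the first
transition, and an independent copy of the process started from the new state. -/
theorem lintegral_jumpLaw (q : E → E → ℝ≥0∞) (x : E) {F : (ℕ → E) × (ℕ → ℝ) → ℝ≥0∞}
    (hF : Measurable F) :
    ∫⁻ ω, F ω ∂(jumpLaw q x) = ∫⁻ e, ∑' y, jumpPMF q x y *
      ∫⁻ ω, F (consSeq x ω.1, consSeq e ω.2) ∂(jumpLaw q y) ∂(expMeasure 1) := by
  have hm : Measurable (consSeq x) := measurable_consSeq.comp measurable_prodMk_left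
  have hF2 : Measurable fun z : (ℝ × E) × ((ℕ → E) × (ℕ → ℝ)) =>
      F (consSeq x z.2.1, consSeq z.1.1 z.2.2) :=
    hF.comp ((hm.comp (by fun_prop)).prodMk
      (measurable_consSeq.comp ((measurable_fst.comp measurable_fst).prodMk
        (measurable_snd.comp measurable_snd))))
  unfold jumpLaw
  set Θ := Measure.infinitePi fun _ : ℕ => expMeasure 1 with hΘ
  have h1 : ∫⁻ ω, F ω ∂((chainLaw q x).prod Θ) =
      ∑' y, jumpPMF q x y * ∫⁻ c, ∫⁻ e, ∫⁻ ε, F (consSeq x c, consSeq e ε) ∂Θ ∂(expMeasure 1)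
        ∂(chainLaw q y) := by
    rw [lintegral_prod _ hF.aemeasurable, chainLaw_eq_sum, lintegral_sum_measure]
    refine tsum_congr fun y => ?_
    rw [lintegral_smul_measure, lintegral_map hF.lintegral_prod_right' hm]
    congr 1
    refine lintegral_congr fun c => ?_
    have hFc : Measurable fun ε => F (consSeq x c, ε) := hF.comp measurable_prodMk_left
    rw [hΘ]
    conv_lhs => rw [← infinitePi_map_consSeq]
    rw [lintegral_map hFc measurable_consSeq,
      lintegral_prod (fun z : ℝ × (ℕ → ℝ) => F (consSeq x c, consSeq z.1 z.2))
        (hFc.comp measurable_consSeq).aemeasurable]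
  have hF3 : ∀ y : E, Measurable fun z : ℝ × ((ℕ → E) × (ℕ → ℝ)) =>
      F (consSeq x z.2.1, consSeq z.1 z.2.2) := fun y =>
    hF2.comp ((measurable_fst.prodMk (measurable_const (a := y))).prodMk measurable_snd)
  rw [h1, lintegral_tsum]
  · refine tsum_congr fun y => ?_
    rw [lintegral_const_mul _ (hF3 y).lintegral_prod_right']
    congr 1
    have hF4 : Measurable fun z : (ℕ → E) × ℝ => ∫⁻ ε, F (consSeq x z.1, consSeq z.2 ε) ∂Θ := by
      have : Measurable fun w : ((ℕ → E) × ℝ) × (ℕ → ℝ) =>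
          F (consSeq x w.1.1, consSeq w.1.2 w.2) :=
        (hF3 y).comp ((measurable_snd.comp measurable_fst).prodMk
          ((measurable_fst.comp measurable_fst).prodMk measurable_snd))
      exact this.lintegral_prod_right'
    rw [lintegral_lintegral_swap hF4.aemeasurable]
    refine lintegral_congr fun e => ?_
    rw [lintegral_prod]
    exact ((hF3 y).comp measurable_prodMk_left).aemeasurable
  · intro y
    exact (((hF3 y).lintegral_prod_right').const_mul _).aemeasurable

end Regeneration

/-! ### Iterates of the first-jump equation -/

section Renewal

variable {E : Type*}

/-- The contribution of the paths that jump before time `t` to a first-jump equation: the process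
leaves `x` at time `s` with density `exp (- r x s) q x y`, and `u (t - s) y` is collected. The
parameter `r x` is the sum of the jump rate and of the killing rate at `x`. -/
noncomputable def jumpStep (q : E → E → ℝ≥0∞) (r : E → ℝ≥0) (u : ℝ → E → ℝ≥0∞) (t : ℝ) (x : E) :
    ℝ≥0∞ :=
  ∫⁻ s in Set.Ioc 0 t, ENNReal.ofReal (Real.exp (-(r x * s))) * ∑' y, q x y * u (t - s) y

/-- The iterates of the backward first-jump equation: `renewalIter q r f g n t x` is the expectation
of `f (X t)` on the event that fewer than `n` jumps occur up to time `t`, plus the expectation of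
`g` at the state reached by the `n`-th jump on the complement (both discounted by the killing). -/
noncomputable def renewalIter (q : E → E → ℝ≥0∞) (r : E → ℝ≥0) (f g : E → ℝ≥0∞) :
    ℕ → ℝ → E → ℝ≥0∞
  | 0, _, x => g x
  | n + 1, t, x => ENNReal.ofReal (Real.exp (-(r x * t))) * f x +
      jumpStep q r (renewalIter q r f g n) t x

variable {q : E → E → ℝ≥0∞} {r : E → ℝ≥0} {f g : E → ℝ≥0∞}

theorem measurable_ofReal_exp_neg (c : ℝ) :
    Measurable fun s : ℝ => ENNReal.ofReal (Real.exp (-(c * s))) := by fun_prop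

theorem measurable_setLIntegral_Ioc {h : ℝ → ℝ → ℝ≥0∞} (hh : Measurable (Function.uncurry h)) :
    Measurable fun t => ∫⁻ s in Set.Ioc 0 t, h t s := by
  have : (fun t => ∫⁻ s in Set.Ioc 0 t, h t s) = fun t => ∫⁻ s,
      ({p : ℝ × ℝ | 0 < p.2 ∧ p.2 ≤ p.1}.indicator (Function.uncurry h)) (t, s) := by
    funext t
    rw [← lintegral_indicator measurableSet_Ioc]
    refine lintegral_congr fun s => ?_
    by_cases hs : s ∈ Set.Ioc 0 t
    · rw [Set.indicator_of_mem hs, Set.indicator_of_mem (by exact hs)]; rfl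
    · rw [Set.indicator_of_notMem hs, Set.indicator_of_notMem (by exact hs)]
  rw [this]
  refine Measurable.lintegral_prod_right' (hh.indicator ?_)
  exact (measurableSet_lt measurable_const measurable_snd).inter
    (measurableSet_le measurable_snd measurable_fst)

theorem measurable_tsum_rate [Countable E] {u : ℝ → E → ℝ≥0∞} (hu : ∀ y, Measurable fun t => u t y)
    (x : E) : Measurable fun t => ∑' y, q x y * u t y :=
  Measurable.tsum fun y => (hu y).const_mul _

theorem measurable_jumpStep [Countable E] {u : ℝ → E → ℝ≥0∞} (hu : ∀ y, Measurable fun t => u t y)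
    (x : E) : Measurable fun t => jumpStep q r u t x := by
  refine measurable_setLIntegral_Ioc (h := fun t s =>
    ENNReal.ofReal (Real.exp (-(r x * s))) * ∑' y, q x y * u (t - s) y) ?_
  exact ((measurable_ofReal_exp_neg _).comp measurable_snd).mul
    ((measurable_tsum_rate hu x).comp (measurable_fst.sub measurable_snd))

theorem measurable_renewalIter [Countable E] (n : ℕ) (x : E) :
    Measurable fun t => renewalIter q r f g n t x := by
  induction n generalizing x with
  | zero => exact measurable_const
  | succ n ih =>
    exact ((measurable_ofReal_exp_neg _).mul_const _).add (measurable_jumpStep ih x)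

theorem jumpStep_mono {u v : ℝ → E → ℝ≥0∞} {t : ℝ} (h : ∀ s, 0 ≤ s → s ≤ t → ∀ y, u s y ≤ v s y)
    (x : E) : jumpStep q r u t x ≤ jumpStep q r v t x := by
  refine setLIntegral_mono' measurableSet_Ioc fun s hs => ?_
  gcongr with y
  exact h _ (by linarith [hs.2]) (by linarith [hs.1]) _

theorem jumpStep_congr {u v : ℝ → E → ℝ≥0∞} {t : ℝ}
    (h : ∀ s, 0 ≤ s → s ≤ t → ∀ y, u s y = v s y) (x : E) :
    jumpStep q r u t x = jumpStep q r v t x :=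
  le_antisymm (jumpStep_mono (fun s h0 h1 y => (h s h0 h1 y).le) x)
    (jumpStep_mono (fun s h0 h1 y => (h s h0 h1 y).ge) x)

theorem jumpStep_add [Countable E] {u v : ℝ → E → ℝ≥0∞} (hu : ∀ y, Measurable fun t => u t y)
    (t : ℝ) (x : E) :
    jumpStep q r (fun s y => u s y + v s y) t x = jumpStep q r u t x + jumpStep q r v t x := by
  unfold jumpStep
  rw [← lintegral_add_left]
  · refine lintegral_congr fun s => ?_
    simp only [mul_add]
    rw [ENNReal.tsum_add, mul_add]
  · exact (measurable_ofReal_exp_neg _).mul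
      ((measurable_tsum_rate hu x).comp (measurable_const.sub measurable_id))

theorem jumpStep_const (V : E → ℝ≥0∞) (t : ℝ) (x : E) :
    jumpStep q r (fun _ => V) t x =
      (∫⁻ s in Set.Ioc 0 t, ENNReal.ofReal (Real.exp (-(r x * s)))) * ∑' y, q x y * V y := by
  unfold jumpStep
  rw [lintegral_mul_const _ (measurable_ofReal_exp_neg _)]

theorem renewalIter_mono {f' g' : E → ℝ≥0∞} (hf : ∀ x, f x ≤ f' x) (hg : ∀ x, g x ≤ g' x)
    (n : ℕ) (t : ℝ) (x : E) : renewalIter q r f g n t x ≤ renewalIter q r f' g' n t x := by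
  induction n generalizing t x with
  | zero => exact hg x
  | succ n ih =>
    refine add_le_add (mul_le_mul_right (hf x) _) (jumpStep_mono (fun s _ _ y => ih s y) x)

theorem renewalIter_add [Countable E] (n : ℕ) (t : ℝ) (x : E) :
    renewalIter q r f g n t x = renewalIter q r f 0 n t x + renewalIter q r 0 g n t x := by
  induction n generalizing t x with
  | zero => simp [renewalIter]
  | succ n ih =>
    simp only [renewalIter, Pi.zero_apply, mul_zero, zero_add, add_assoc]
    rw [← jumpStep_add (fun y => measurable_renewalIter n y)]
    congr 1
    exact jumpStep_congr (fun s _ _ y => ih s y) x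

theorem renewalIter_const_mul [Countable E] (c : ℝ≥0∞) (n : ℕ) (t : ℝ) (x : E) :
    renewalIter q r (fun x => c * f x) (fun x => c * g x) n t x =
      c * renewalIter q r f g n t x := by
  induction n generalizing t x with
  | zero => simp [renewalIter]
  | succ n ih =>
    simp only [renewalIter, mul_add]
    congr 1
    · ring
    · unfold jumpStep
      rw [← lintegral_const_mul]
      · refine lintegral_congr fun s => ?_
        simp only [ih, mul_left_comm _ c, ENNReal.tsum_mul_left]
      · exact (measurable_ofReal_exp_neg _).mul ((measurable_tsum_rate
          (fun y => measurable_renewalIter n y) x).comp (measurable_const.sub measurable_id))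

/-- The exponential law with rate `r`, read against `exp (c (t - s))`: the part of the mass that
survives `t` and the part that does not add up. -/
theorem exp_add_lintegral_exp (r c : ℝ≥0) {t : ℝ} (ht : 0 ≤ t) :
    ENNReal.ofReal (Real.exp (-(r * t))) + (r + c) * ∫⁻ s in Set.Ioc 0 t,
      ENNReal.ofReal (Real.exp (-(r * s))) * ENNReal.ofReal (Real.exp (c * (t - s))) =
        ENNReal.ofReal (Real.exp (c * t)) := by
  have hder : ∀ s ∈ Set.uIcc 0 t, HasDerivAt (fun s : ℝ => -Real.exp (c * t - (r + c) * s))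
      ((r + c) * Real.exp (c * t - (r + c) * s)) s := by
    intro s _
    have h1 : HasDerivAt (fun s : ℝ => (c : ℝ) * t - (r + c) * s) (-(r + c)) s := by
      simpa using ((hasDerivAt_id s).const_mul ((r : ℝ) + c)).const_sub ((c : ℝ) * t)
    exact (h1.exp.neg).congr_deriv (by ring)
  have hint := intervalIntegral.integral_eq_sub_of_hasDerivAt hder
    (Continuous.intervalIntegrable (by fun_prop) _ _)
  have hrc : ((r : ℝ≥0∞) + c) = ENNReal.ofReal ((r : ℝ) + c) := by
    rw [ENNReal.ofReal_add r.coe_nonneg c.coe_nonneg]; simp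
  have h2 : (r + c) * ∫⁻ s in Set.Ioc 0 t, ENNReal.ofReal (Real.exp (-(r * s))) *
      ENNReal.ofReal (Real.exp (c * (t - s))) =
      ENNReal.ofReal (∫ s in (0 : ℝ)..t, (r + c) * Real.exp (c * t - (r + c) * s)) := by
    rw [intervalIntegral.integral_of_le ht, ofReal_integral_eq_lintegral_ofReal, hrc,
      ← lintegral_const_mul]
    · refine lintegral_congr fun s => ?_
      rw [← ENNReal.ofReal_mul (Real.exp_nonneg _), ← Real.exp_add,
        ← ENNReal.ofReal_mul (by positivity)]
      congr 3
      ring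
    · fun_prop
    · exact (Continuous.integrableOn_Icc (by fun_prop)).mono_set Set.Ioc_subset_Icc_self
    · exact Filter.Eventually.of_forall fun s => by positivity
  have hle : Real.exp (-(r * t)) ≤ Real.exp (c * t) := by
    refine Real.exp_le_exp.2 ?_
    have := mul_nonneg r.2 ht
    have := mul_nonneg c.2 ht
    simp only [NNReal.val_eq_coe] at *
    linarith
  rw [h2, hint, ← ENNReal.ofReal_add (Real.exp_nonneg _)]
  · congr 1
    have : (c : ℝ) * t - (r + c) * t = -(r * t) := by ring
    rw [this]
    simp
  · have : (c : ℝ) * t - (r + c) * t = -(r * t) := by ring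
    rw [this]
    simpa using hle

theorem exp_add_lintegral_exp_zero (r : ℝ≥0) {t : ℝ} (ht : 0 ≤ t) :
    ENNReal.ofReal (Real.exp (-(r * t))) + r * ∫⁻ s in Set.Ioc 0 t,
      ENNReal.ofReal (Real.exp (-(r * s))) = 1 := by
  simpa using exp_add_lintegral_exp r 0 ht

/-- Fubini's theorem on the triangle `0 < s ≤ w ≤ t`: the time integral of a first-jump term is the
first-jump term of the time integral. -/
theorem setLIntegral_jumpStep [Countable E] {u : ℝ → E → ℝ≥0∞}
    (hu : ∀ y, Measurable fun t => u t y) (t : ℝ) (x : E) :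
    ∫⁻ w in Set.Ioc 0 t, jumpStep q r u w x =
      jumpStep q r (fun t y => ∫⁻ s in Set.Ioc 0 t, u s y) t x := by
  set U : ℝ → ℝ≥0∞ := fun t => ∑' y, q x y * u t y with hU
  have hUm : Measurable U := measurable_tsum_rate hu x
  set e : ℝ → ℝ≥0∞ := fun s => ENNReal.ofReal (Real.exp (-(r x * s))) with he
  have hem : Measurable e := measurable_ofReal_exp_neg _
  set D : Set (ℝ × ℝ) := {p | 0 < p.2 ∧ p.2 ≤ p.1 ∧ p.1 ≤ t} with hD
  have hDm : MeasurableSet D :=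
    (measurableSet_lt measurable_const measurable_snd).inter
      ((measurableSet_le measurable_snd measurable_fst).inter
        (measurableSet_le measurable_fst measurable_const))
  set H : ℝ × ℝ → ℝ≥0∞ := D.indicator fun p => e p.2 * U (p.1 - p.2) with hH
  have hHm : Measurable H := ((hem.comp measurable_snd).mul
    (hUm.comp (measurable_fst.sub measurable_snd))).indicator hDm
  have h1 : ∫⁻ w in Set.Ioc 0 t, jumpStep q r u w x = ∫⁻ w, ∫⁻ s, H (w, s) := by
    rw [← lintegral_indicator measurableSet_Ioc]
    refine lintegral_congr fun w => ?_
    by_cases hw : w ∈ Set.Ioc 0 t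
    · rw [Set.indicator_of_mem hw]
      unfold jumpStep
      rw [← lintegral_indicator measurableSet_Ioc]
      refine lintegral_congr fun s => ?_
      by_cases hs : s ∈ Set.Ioc 0 w
      · rw [Set.indicator_of_mem hs, hH, Set.indicator_of_mem (show (w, s) ∈ D from
          ⟨hs.1, hs.2, hw.2⟩)]
      · rw [Set.indicator_of_notMem hs, hH, Set.indicator_of_notMem]
        exact fun h => hs ⟨h.1, h.2.1⟩
    · rw [Set.indicator_of_notMem hw]
      refine (lintegral_eq_zero_of_ae_eq_zero (Filter.Eventually.of_forall fun s => ?_)).symm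
      rw [hH]
      exact Set.indicator_of_notMem (fun h => hw ⟨h.1.trans_le h.2.1, h.2.2⟩) _
  rw [h1, lintegral_lintegral_swap (f := fun w s => H (w, s)) hHm.aemeasurable]
  unfold jumpStep
  rw [← lintegral_indicator measurableSet_Ioc]
  refine lintegral_congr fun s => ?_
  by_cases hs : s ∈ Set.Ioc 0 t
  · rw [Set.indicator_of_mem hs]
    have h2 : ∀ w, H (w, s) = e s * (Set.Icc 0 (t - s)).indicator U (w - s) := by
      intro w
      by_cases hw : s ≤ w ∧ w ≤ t
      · rw [hH, Set.indicator_of_mem (show (w, s) ∈ D from ⟨hs.1, hw⟩), Set.indicator_of_mem]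
        exact ⟨by linarith [hw.1], by linarith [hw.2]⟩
      · rw [hH, Set.indicator_of_notMem (fun h => hw h.2), Set.indicator_of_notMem, mul_zero]
        exact fun h => hw ⟨by linarith [h.1], by linarith [h.2]⟩
    simp only [h2]
    have hUi : Measurable fun w => (Set.Icc 0 (t - s)).indicator U (w - s) :=
      (hUm.indicator measurableSet_Icc).comp (measurable_id.sub measurable_const)
    rw [lintegral_const_mul _ hUi,
      lintegral_sub_right_eq_self (μ := volume) (fun w => (Set.Icc 0 (t - s)).indicator U w) s,
      lintegral_indicator measurableSet_Icc, setLIntegral_congr Ioc_ae_eq_Icc.symm, hU,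
      lintegral_tsum fun y => ((hu y).const_mul _).aemeasurable]
    congr 2
    funext y
    rw [lintegral_const_mul _ (hu y)]
  · rw [Set.indicator_of_notMem hs]
    refine lintegral_eq_zero_of_ae_eq_zero (Filter.Eventually.of_forall fun w => ?_)
    rw [hH]
    exact Set.indicator_of_notMem (fun h => hs ⟨h.1, h.2.1.trans h.2.2⟩) _

/-- Dynkin's formula for the process stopped at its `n`-th jump. The generator applied to `V` enters
as the difference `b - a` of two nonnegative functions, so that no integrability is needed. -/
theorem renewalIter_dynkin [Countable E] {V a b : E → ℝ≥0∞}
    (h : ∀ x, ∑' y, q x y * V y + a x = r x * V x + b x) (n : ℕ) {t : ℝ} (ht : 0 ≤ t) (x : E) :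
    renewalIter q r V V n t x + ∫⁻ s in Set.Ioc 0 t, renewalIter q r a 0 n s x =
      V x + ∫⁻ s in Set.Ioc 0 t, renewalIter q r b 0 n s x := by
  induction n generalizing t x with
  | zero => simp [renewalIter]
  | succ n ih =>
    have hint : ∀ c : E → ℝ≥0∞, ∫⁻ s in Set.Ioc 0 t, renewalIter q r c 0 (n + 1) s x =
        (∫⁻ s in Set.Ioc 0 t, ENNReal.ofReal (Real.exp (-(r x * s)))) * c x +
        jumpStep q r (fun t y => ∫⁻ s in Set.Ioc 0 t, renewalIter q r c 0 n s y) t x := by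
      intro c
      simp only [renewalIter]
      rw [lintegral_add_left ((measurable_ofReal_exp_neg _).mul_const _),
        lintegral_mul_const _ (measurable_ofReal_exp_neg _),
        setLIntegral_jumpStep fun y => measurable_renewalIter n y]
    rw [hint a, hint b]
    simp only [renewalIter]
    set I := ∫⁻ s in Set.Ioc 0 t, ENNReal.ofReal (Real.exp (-(r x * s))) with hI
    have hJ : jumpStep q r (renewalIter q r V V n) t x +
        jumpStep q r (fun t y => ∫⁻ s in Set.Ioc 0 t, renewalIter q r a 0 n s y) t x =
        I * ∑' y, q x y * V y +
        jumpStep q r (fun t y => ∫⁻ s in Set.Ioc 0 t, renewalIter q r b 0 n s y) t x := by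
      rw [← jumpStep_add (fun y => measurable_renewalIter n y), hI, ← jumpStep_const,
        ← jumpStep_add (u := fun _ => V) (fun y => measurable_const)]
      exact jumpStep_congr (fun s hs _ y => ih hs y) x
    calc _ = ENNReal.ofReal (Real.exp (-(r x * t))) * V x + I * a x +
          (jumpStep q r (renewalIter q r V V n) t x +
            jumpStep q r (fun t y => ∫⁻ s in Set.Ioc 0 t, renewalIter q r a 0 n s y) t x) := by
          ring
      _ = ENNReal.ofReal (Real.exp (-(r x * t))) * V x + I * (∑' y, q x y * V y + a x) +
            jumpStep q r (fun t y => ∫⁻ s in Set.Ioc 0 t, renewalIter q r b 0 n s y) t x := by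
          rw [hJ]; ring
      _ = (ENNReal.ofReal (Real.exp (-(r x * t))) + r x * I) * V x + I * b x +
            jumpStep q r (fun t y => ∫⁻ s in Set.Ioc 0 t, renewalIter q r b 0 n s y) t x := by
          rw [h]; ring
      _ = _ := by
          rw [hI, exp_add_lintegral_exp_zero _ ht]; ring

theorem jumpStep_exp_mul (V : E → ℝ≥0∞) (c : ℝ) (K : ℝ≥0∞) (t : ℝ) (x : E) :
    jumpStep q r (fun s y => ENNReal.ofReal (Real.exp (c * s)) * (K * V y)) t x =
      (∫⁻ s in Set.Ioc 0 t, ENNReal.ofReal (Real.exp (-(r x * s))) *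
        ENNReal.ofReal (Real.exp (c * (t - s)))) * (K * ∑' y, q x y * V y) := by
  unfold jumpStep
  rw [← lintegral_mul_const _ (by fun_prop)]
  refine lintegral_congr fun s => ?_
  have : ∀ y, q x y * (ENNReal.ofReal (Real.exp (c * (t - s))) * (K * V y)) =
      (ENNReal.ofReal (Real.exp (c * (t - s))) * K) * (q x y * V y) := fun y => by ring
  simp only [this, ENNReal.tsum_mul_left]
  ring

theorem renewalIter_le_exp {V : E → ℝ≥0∞} {c : ℝ≥0}
    (h : ∀ x, ∑' y, q x y * V y ≤ (r x + c) * V x) (n : ℕ) {t : ℝ} (ht : 0 ≤ t) (x : E) :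
    renewalIter q r V V n t x ≤ ENNReal.ofReal (Real.exp (c * t)) * V x := by
  induction n generalizing t x with
  | zero =>
    refine le_mul_of_one_le_left (zero_le) ?_
    rw [ENNReal.one_le_ofReal]
    exact Real.one_le_exp (mul_nonneg c.2 ht)
  | succ n ih =>
    have h1 := jumpStep_mono (q := q) (r := r) (u := renewalIter q r V V n)
      (v := fun s y => ENNReal.ofReal (Real.exp (c * s)) * (1 * V y)) (t := t)
      (fun s hs _ y => by simpa using ih hs y) x
    rw [jumpStep_exp_mul] at h1
    calc _ ≤ ENNReal.ofReal (Real.exp (-(r x * t))) * V x +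
        (∫⁻ s in Set.Ioc 0 t, ENNReal.ofReal (Real.exp (-(r x * s))) *
          ENNReal.ofReal (Real.exp (c * (t - s)))) * (1 * ((r x + c) * V x)) := by
          refine add_le_add le_rfl (h1.trans ?_)
          gcongr
          exact h x
      _ = (ENNReal.ofReal (Real.exp (-(r x * t))) + (r x + c) *
        ∫⁻ s in Set.Ioc 0 t, ENNReal.ofReal (Real.exp (-(r x * s))) *
          ENNReal.ofReal (Real.exp (c * (t - s)))) * V x := by ring
      _ = _ := by rw [exp_add_lintegral_exp _ _ ht]

theorem renewalIter_le_one (hq : ∀ x, ∑' y, q x y ≤ r x) (n : ℕ) {t : ℝ} (ht : 0 ≤ t) (x : E) :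
    renewalIter q r 0 1 n t x ≤ 1 := by
  refine (renewalIter_mono (f' := 1) (g' := 1) (fun _ => zero_le) (fun _ => le_rfl) n t x).trans ?_
  simpa using renewalIter_le_exp (q := q) (r := r) (V := 1) (c := 0)
    (fun x => by simpa using hq x) n ht x

/-- Non-explosion: if `V` dominates the jump rates and `L V ≤ c V`, the probability of at least `n`
jumps up to time `t` tends to `0`. Where `V` is at least `M` this probability is at most `V / M`; where `V`
is smaller than `M` the rates are bounded, and each jump contracts by the factor `θ`. -/
theorem tendsto_renewalIter_zero {V : E → ℝ≥0∞} {c : ℝ≥0} (hV1 : ∀ x, 1 ≤ V x)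
    (hVtop : ∀ x, V x ≠ ∞) (hr : ∀ x, (r x : ℝ≥0∞) ≤ V x) (hq : ∀ x, ∑' y, q x y ≤ r x)
    (h : ∀ x, ∑' y, q x y * V y ≤ (r x + c) * V x) {t : ℝ} (ht : 0 ≤ t) (x : E) :
    Filter.Tendsto (fun n => renewalIter q r 0 1 n t x) Filter.atTop (𝓝 0) := by
  have key : ∀ M : ℕ, 0 < M → ∃ θ : ℝ≥0, θ < 1 ∧ ∀ (n : ℕ) (t : ℝ), 0 ≤ t → ∀ x,
      renewalIter q r 0 1 n t x ≤ ENNReal.ofReal (Real.exp ((c + 1 : ℝ≥0) * t)) *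
        (((M : ℝ≥0∞)⁻¹ + (θ : ℝ≥0∞) ^ n) * V x) := by
    intro M hM
    have hM0 : (M : ℝ≥0∞) ≠ 0 := by exact_mod_cast hM.ne'
    refine ⟨(M + c) / (M + c + 1), (div_lt_one (by positivity)).2 (lt_add_one _), fun n => ?_⟩
    set θ : ℝ≥0 := (M + c) / (M + c + 1) with hθ
    have hθ1 : θ ≤ 1 := ((div_lt_one (by positivity)).2 (lt_add_one _)).le
    have hexp : ∀ t : ℝ, 0 ≤ t → 1 ≤ ENNReal.ofReal (Real.exp ((c + 1 : ℝ≥0) * t)) := by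
      intro t ht
      rw [ENNReal.one_le_ofReal]
      exact Real.one_le_exp (mul_nonneg (c + 1).2 ht)
    induction n with
    | zero =>
      intro t ht x
      simp only [renewalIter, Pi.one_apply, pow_zero]
      refine (hV1 x).trans (le_mul_of_one_le_of_le (hexp t ht) ?_)
      exact le_mul_of_one_le_left zero_le le_add_self
    | succ n ih =>
      intro t ht x
      rcases le_or_gt (M : ℝ≥0∞) (V x) with hx | hx
      · refine (renewalIter_le_one hq _ ht x).trans (one_le_mul (hexp t ht) ?_)
        calc (1 : ℝ≥0∞) = (M : ℝ≥0∞)⁻¹ * M := (ENNReal.inv_mul_cancel hM0 (by simp)).symm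
          _ ≤ _ := mul_le_mul' le_self_add hx
      · have hrM : r x ≤ (M : ℝ≥0) := by
          have := (hr x).trans hx.le
          exact_mod_cast this
        have hcontr : r x + c ≤ θ * (r x + (c + 1)) := by
          rw [hθ, div_mul_eq_mul_div, le_div_iff₀ (by positivity), ← NNReal.coe_le_coe]
          have h1 : (r x : ℝ) ≤ M := by exact_mod_cast hrM
          push_cast
          nlinarith
        have hcontr' : (r x + c : ℝ≥0∞) ≤ θ * (r x + (c + 1 : ℝ≥0)) := by exact_mod_cast hcontr
        set K : ℝ≥0∞ := (M : ℝ≥0∞)⁻¹ + (θ : ℝ≥0∞) ^ n with hK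
        set I := ∫⁻ s in Set.Ioc 0 t, ENNReal.ofReal (Real.exp (-(r x * s))) *
          ENNReal.ofReal (Real.exp ((c + 1 : ℝ≥0) * (t - s))) with hI
        have hIle : (r x + (c + 1 : ℝ≥0)) * I ≤
            ENNReal.ofReal (Real.exp ((c + 1 : ℝ≥0) * t)) := by
          rw [← exp_add_lintegral_exp (r x) (c + 1) ht]
          exact le_add_self
        have hKθ : K * θ ≤ (M : ℝ≥0∞)⁻¹ + (θ : ℝ≥0∞) ^ (n + 1) := by
          rw [hK, add_mul, pow_succ]
          gcongr
          exact mul_le_of_le_one_right zero_le (by exact_mod_cast hθ1)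
        have h1 := jumpStep_mono (q := q) (r := r) (u := renewalIter q r 0 1 n)
          (v := fun s y => ENNReal.ofReal (Real.exp ((c + 1 : ℝ≥0) * s)) * (K * V y)) (t := t)
          (fun s hs _ y => ih s hs y) x
        rw [jumpStep_exp_mul, ← hI] at h1
        calc renewalIter q r 0 1 (n + 1) t x = jumpStep q r (renewalIter q r 0 1 n) t x := by
              simp [renewalIter]
          _ ≤ I * (K * ((r x + c) * V x)) := h1.trans (by gcongr; exact h x)
          _ ≤ I * (K * (θ * (r x + (c + 1 : ℝ≥0)) * V x)) := by gcongr
          _ = ((r x + (c + 1 : ℝ≥0)) * I) * ((K * θ) * V x) := by ring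
          _ ≤ _ := by gcongr
  set A := ENNReal.ofReal (Real.exp ((c + 1 : ℝ≥0) * t)) * V x with hA
  have hAtop : A ≠ ∞ := ENNReal.mul_ne_top ENNReal.ofReal_ne_top (hVtop x)
  rw [ENNReal.tendsto_nhds_zero]
  intro ε hε
  have hM : Filter.Tendsto (fun M : ℕ => A * (M : ℝ≥0∞)⁻¹) Filter.atTop (𝓝 0) := by
    simpa using ENNReal.Tendsto.const_mul ENNReal.tendsto_inv_nat_nhds_zero (Or.inr hAtop)
  obtain ⟨M, hMε, hM0⟩ := ((hM.eventually_lt_const (ENNReal.half_pos hε.ne')).and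
    (Filter.eventually_gt_atTop 0)).exists
  obtain ⟨θ, hθ, hb⟩ := key M hM0
  have hn : Filter.Tendsto (fun n : ℕ => A * (θ : ℝ≥0∞) ^ n) Filter.atTop (𝓝 0) := by
    simpa using ENNReal.Tendsto.const_mul
      (ENNReal.tendsto_pow_atTop_nhds_zero_of_lt_one (by exact_mod_cast hθ)) (Or.inr hAtop)
  filter_upwards [hn.eventually_lt_const (ENNReal.half_pos hε.ne')] with n hn
  calc _ ≤ _ := hb n t ht x
    _ = A * (M : ℝ≥0∞)⁻¹ + A * (θ : ℝ≥0∞) ^ n := by rw [hA]; ring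
    _ ≤ ε / 2 + ε / 2 := add_le_add hMε.le hn.le
    _ = ε := ENNReal.add_halves ε

end Renewal

/-! ### The exponential law -/

section Exponential

theorem expMeasure_one_Ioi {a : ℝ} (ha : 0 ≤ a) :
    expMeasure 1 (Set.Ioi a) = ENNReal.ofReal (Real.exp (-a)) := by
  have h : Real.exp (-a) ≤ 1 := Real.exp_le_one_iff.2 (by linarith)
  rw [← Set.compl_Iic, prob_compl_eq_one_sub measurableSet_Iic, ← ofReal_cdf,
    cdf_expMeasure_eq one_pos, if_pos ha, one_mul, ← ENNReal.ofReal_one,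
    ← ENNReal.ofReal_sub _ (by linarith)]
  congr 1
  ring

theorem ae_pos_expMeasure_one : ∀ᵐ e ∂(expMeasure 1), 0 < e := by
  have h := expMeasure_one_Ioi le_rfl
  rw [neg_zero, Real.exp_zero, ENNReal.ofReal_one] at h
  exact (prob_compl_eq_zero_iff measurableSet_Ioi).2 h

theorem lintegral_expMeasure_one {H : ℝ → ℝ≥0∞} (hH : Measurable H) :
    ∫⁻ e, H e ∂(expMeasure 1) =
      ∫⁻ e in Set.Ioi 0, ENNReal.ofReal (Real.exp (-e)) * H e := by
  have h1 : expMeasure 1 = volume.withDensity (exponentialPDF 1) := rfl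
  have hm : Measurable (exponentialPDF 1) :=
    (measurable_exponentialPDFReal 1).ennreal_ofReal
  rw [h1, lintegral_withDensity_eq_lintegral_mul _ hm hH,
    setLIntegral_congr Ioi_ae_eq_Ici, ← lintegral_indicator measurableSet_Ici]
  refine lintegral_congr fun e => ?_
  by_cases he : 0 ≤ e
  · rw [Set.indicator_of_mem (Set.mem_Ici.2 he), Pi.mul_apply, exponentialPDF_of_nonneg he]
    simp
  · rw [Set.indicator_of_notMem (by simpa using he), Pi.mul_apply,
      exponentialPDF_of_neg (by simpa using he), zero_mul]

/-- A standard exponential variable divided by `Q` has density `Q exp (-Q s)`. -/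
theorem lintegral_expMeasure_one_div {Q : ℝ} (hQ : 0 < Q) {H : ℝ → ℝ≥0∞} (hH : Measurable H) :
    ∫⁻ e, H (e / Q) ∂(expMeasure 1) =
      ENNReal.ofReal Q * ∫⁻ s in Set.Ioi 0, ENNReal.ofReal (Real.exp (-(Q * s))) * H s := by
  have hHQ : Measurable fun e => H (e / Q) := hH.comp (measurable_id.div_const Q)
  rw [lintegral_expMeasure_one hHQ,
    ← lintegral_indicator measurableSet_Ioi, ← lintegral_indicator measurableSet_Ioi]
  conv_lhs => rw [← Real.smul_map_volume_mul_left hQ.ne']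
  rw [lintegral_smul_measure, lintegral_map _ (measurable_const_mul Q), abs_of_pos hQ]
  · rw [smul_eq_mul]
    congr 1
    refine lintegral_congr fun s => ?_
    by_cases hs : 0 < s
    · rw [Set.indicator_of_mem (Set.mem_Ioi.2 (mul_pos hQ hs)),
        Set.indicator_of_mem (Set.mem_Ioi.2 hs), mul_div_cancel_left₀ _ hQ.ne']
    · rw [Set.indicator_of_notMem, Set.indicator_of_notMem (by simpa using hs)]
      simp only [Set.mem_Ioi, not_lt] at hs ⊢
      exact mul_nonpos_of_nonneg_of_nonpos hQ.le hs
  · exact ((Real.measurable_exp.comp measurable_neg).ennreal_ofReal.mul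
      (hH.comp (measurable_id.div_const Q))).indicator measurableSet_Ioi

end Exponential

/-! ### First-jump decomposition of the jump process -/

section Path

variable {E : Type*}

/-- The accumulated killing rate `∫_0^t κ (X_s) ds` along a path. -/
noncomputable def killingClock (q : E → E → ℝ≥0∞) (κ : E → ℝ≥0) (t : ℝ)
    (ω : (ℕ → E) × (ℕ → ℝ)) : ℝ≥0∞ :=
  ∫⁻ s in Set.Ioc 0 t, (κ (jumpProcess q s ω) : ℝ≥0∞)

/-- The conditional probability, given the path, of having survived the killing up to time `t`.
It has this meaning when the accumulated rate is finite, as it is for bounded `κ`. -/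
noncomputable def discount (q : E → E → ℝ≥0∞) (κ : E → ℝ≥0) (t : ℝ)
    (ω : (ℕ → E) × (ℕ → ℝ)) : ℝ≥0∞ :=
  ENNReal.ofReal (Real.exp (-(killingClock q κ t ω).toReal))

/-- The discounted value of `f` at time `t`, on the event of fewer than `n` jumps up to `t`. -/
noncomputable def truncatedValue (q : E → E → ℝ≥0∞) (κ : E → ℝ≥0) (f : E → ℝ≥0∞) (n : ℕ) (t : ℝ) :
    (ℕ → E) × (ℕ → ℝ) → ℝ≥0∞ :=
  {ω | ENNReal.ofReal t < jumpTime q n ω}.indicator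
    fun ω => f (jumpProcess q t ω) * discount q κ t ω

variable {q : E → E → ℝ≥0∞} {κ : E → ℝ≥0} {f : E → ℝ≥0∞} {x : E} {c : ℕ → E} {e : ℝ} {ε : ℕ → ℝ}

theorem jumpTime_mono (q : E → E → ℝ≥0∞) (ω : (ℕ → E) × (ℕ → ℝ)) :
    Monotone fun n => jumpTime q n ω := by
  intro n m h
  exact Finset.sum_le_sum_of_subset (Finset.range_mono h)

theorem jumpTime_consSeq (n : ℕ) :
    jumpTime q (n + 1) (consSeq x c, consSeq e ε) =
      ENNReal.ofReal e / totalRate q x + jumpTime q n (c, ε) := by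
  simp [jumpTime, Finset.sum_range_succ', add_comm]

theorem jumpProcess_consSeq_of_lt {t : ℝ}
    (h : ENNReal.ofReal t < ENNReal.ofReal e / totalRate q x) :
    jumpProcess q t (consSeq x c, consSeq e ε) = x := by
  have : sInf {n : ℕ | ENNReal.ofReal t < jumpTime q (n + 1) (consSeq x c, consSeq e ε)} = 0 := by
    rw [Nat.sInf_eq_zero]
    left
    simp only [Set.mem_ofPred_eq, jumpTime_consSeq]
    exact h.trans_le le_self_add
  simp [jumpProcess, this]

theorem ofReal_lt_add_iff {s t : ℝ} (hs : 0 ≤ s) (hst : s ≤ t) (a : ℝ≥0∞) :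
    ENNReal.ofReal t < ENNReal.ofReal s + a ↔ ENNReal.ofReal (t - s) < a := by
  have : ENNReal.ofReal t = ENNReal.ofReal s + ENNReal.ofReal (t - s) := by
    rw [← ENNReal.ofReal_add hs (by linarith)]; congr 1; ring
  rw [this, ENNReal.add_lt_add_iff_left ENNReal.ofReal_ne_top]

/-- After the first jump, at time `s`, the process is a translate of the process built on the
shifted sequences. The hypothesis `hn` excludes an explosion before time `t`, where the default value of the
process is not compatible with the shift. -/
theorem jumpProcess_consSeq_of_le {s t : ℝ} {n : ℕ} (hs : 0 ≤ s) (hst : s ≤ t)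
    (h : ENNReal.ofReal e / totalRate q x = ENNReal.ofReal s)
    (hn : ENNReal.ofReal (t - s) < jumpTime q n (c, ε)) :
    jumpProcess q t (consSeq x c, consSeq e ε) = jumpProcess q (t - s) (c, ε) := by
  set p : ℕ → Prop := fun n =>
    ENNReal.ofReal t < jumpTime q (n + 1) (consSeq x c, consSeq e ε) with hp
  have hiff : ∀ m, p m ↔ ENNReal.ofReal (t - s) < jumpTime q m (c, ε) := fun m => by
    rw [hp]
    simp only [jumpTime_consSeq, h]
    exact ofReal_lt_add_iff hs hst _
  have h0 : ¬ p 0 := by rw [hiff]; simp [jumpTime]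
  have h1 : 1 ≤ sInf {m | p m} := by
    have hmem : sInf {m | p m} ∈ {m | p m} := Nat.sInf_mem ⟨n, (hiff n).2 hn⟩
    rw [Nat.one_le_iff_ne_zero]
    intro h
    rw [h] at hmem
    exact h0 hmem
  have h2 := Nat.sInf_add h1
  have h3 : sInf {m | p m} =
      sInf {m | ENNReal.ofReal (t - s) < jumpTime q (m + 1) (c, ε)} + 1 := by
    rw [← h2]
    simp only [hiff]
  unfold jumpProcess
  change consSeq x c (sInf {m | p m}) = _
  rw [h3]
  rfl

theorem killingClock_consSeq_of_lt {t : ℝ}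
    (h : ENNReal.ofReal t < ENNReal.ofReal e / totalRate q x) :
    killingClock q κ t (consSeq x c, consSeq e ε) = κ x * ENNReal.ofReal t := by
  unfold killingClock
  rw [setLIntegral_congr_fun (g := fun _ => (κ x : ℝ≥0∞)) measurableSet_Ioc]
  · simp
  · intro s hs
    simp only
    rw [jumpProcess_consSeq_of_lt ((ENNReal.ofReal_le_ofReal hs.2).trans_lt h)]

theorem killingClock_consSeq_of_le {s t : ℝ} {n : ℕ} (hs : 0 ≤ s) (hst : s ≤ t)
    (h : ENNReal.ofReal e / totalRate q x = ENNReal.ofReal s)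
    (hn : ENNReal.ofReal (t - s) < jumpTime q n (c, ε)) :
    killingClock q κ t (consSeq x c, consSeq e ε) =
      κ x * ENNReal.ofReal s + killingClock q κ (t - s) (c, ε) := by
  unfold killingClock
  rw [← Set.Ioc_union_Ioc_eq_Ioc hs hst, lintegral_union measurableSet_Ioc
    (Set.Ioc_disjoint_Ioc_of_le le_rfl)]
  congr 1
  · rw [setLIntegral_congr Ioo_ae_eq_Ioc.symm,
      setLIntegral_congr_fun (g := fun _ => (κ x : ℝ≥0∞)) measurableSet_Ioo]
    · simp
    · intro r hr
      simp only
      rw [jumpProcess_consSeq_of_lt]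
      rw [h]
      exact (ENNReal.ofReal_lt_ofReal_iff (hr.1.trans hr.2)).2 hr.2
  · rw [setLIntegral_congr_fun
      (g := fun r => (κ (jumpProcess q (r - s) (c, ε)) : ℝ≥0∞)) measurableSet_Ioc]
    · rw [← lintegral_indicator measurableSet_Ioc, ← lintegral_indicator measurableSet_Ioc,
        ← lintegral_sub_right_eq_self (μ := volume) ((Set.Ioc 0 (t - s)).indicator _) s]
      refine lintegral_congr fun r => ?_
      by_cases hr : r ∈ Set.Ioc s t
      · rw [Set.indicator_of_mem hr, Set.indicator_of_mem]
        exact ⟨by linarith [hr.1], by linarith [hr.2]⟩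
      · rw [Set.indicator_of_notMem hr, Set.indicator_of_notMem]
        exact fun h => hr ⟨by linarith [h.1], by linarith [h.2]⟩
    · intro r hr
      simp only
      rw [jumpProcess_consSeq_of_le hs hr.1.le h
        ((ENNReal.ofReal_le_ofReal (by linarith [hr.2])).trans_lt hn)]

theorem killingClock_le {K : ℝ≥0} (hκ : ∀ x, κ x ≤ K) (t : ℝ) (ω : (ℕ → E) × (ℕ → ℝ)) :
    killingClock q κ t ω ≤ K * ENNReal.ofReal t := by
  unfold killingClock
  calc _ ≤ ∫⁻ s in Set.Ioc 0 t, (K : ℝ≥0∞) := by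
        refine lintegral_mono fun s => ?_
        exact ENNReal.coe_le_coe.2 (hκ _)
    _ = _ := by simp

theorem killingClock_ne_top {K : ℝ≥0} (hκ : ∀ x, κ x ≤ K) (t : ℝ) (ω : (ℕ → E) × (ℕ → ℝ)) :
    killingClock q κ t ω ≠ ∞ :=
  ne_top_of_le_ne_top (ENNReal.mul_ne_top ENNReal.coe_ne_top ENNReal.ofReal_ne_top)
    (killingClock_le hκ t ω)

/-- Before the first jump the path is constant. -/
theorem truncatedValue_consSeq_of_lt {t : ℝ} (ht : 0 ≤ t) (n : ℕ)
    (h : ENNReal.ofReal t < ENNReal.ofReal e / totalRate q x) :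
    truncatedValue q κ f (n + 1) t (consSeq x c, consSeq e ε) =
      f x * ENNReal.ofReal (Real.exp (-(κ x * t))) := by
  unfold truncatedValue discount
  rw [Set.indicator_of_mem, jumpProcess_consSeq_of_lt h, killingClock_consSeq_of_lt h]
  · rw [ENNReal.toReal_mul, ENNReal.toReal_ofReal ht, ENNReal.coe_toReal]
  · simp only [Set.mem_ofPred_eq, jumpTime_consSeq]
    exact h.trans_le le_self_add

/-- After the first jump, at time `s`, the path is a translate of a fresh path. -/
theorem truncatedValue_consSeq_of_le {K : ℝ≥0} (hκ : ∀ x, κ x ≤ K) {s t : ℝ} (hs : 0 ≤ s)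
    (hst : s ≤ t) (n : ℕ) (h : ENNReal.ofReal e / totalRate q x = ENNReal.ofReal s) :
    truncatedValue q κ f (n + 1) t (consSeq x c, consSeq e ε) =
      ENNReal.ofReal (Real.exp (-(κ x * s))) * truncatedValue q κ f n (t - s) (c, ε) := by
  unfold truncatedValue discount
  by_cases hn : ENNReal.ofReal (t - s) < jumpTime q n (c, ε)
  · have hn' : ENNReal.ofReal t < jumpTime q (n + 1) (consSeq x c, consSeq e ε) := by
      rw [jumpTime_consSeq, h]
      exact (ofReal_lt_add_iff hs hst _).2 hn
    rw [Set.indicator_of_mem (by exact hn'), Set.indicator_of_mem (by exact hn),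
      jumpProcess_consSeq_of_le hs hst h hn, killingClock_consSeq_of_le hs hst h hn,
      ENNReal.toReal_add _ (killingClock_ne_top hκ _ _), neg_add, Real.exp_add,
      ENNReal.ofReal_mul (Real.exp_nonneg _), ENNReal.toReal_mul, ENNReal.toReal_ofReal hs,
      ENNReal.coe_toReal]
    · ring
    · exact ENNReal.mul_ne_top ENNReal.coe_ne_top ENNReal.ofReal_ne_top
  · have hn' : ¬ ENNReal.ofReal t < jumpTime q (n + 1) (consSeq x c, consSeq e ε) := by
      rw [jumpTime_consSeq, h]
      exact fun h' => hn ((ofReal_lt_add_iff hs hst _).1 h')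
    rw [Set.indicator_of_notMem (by exact hn'), Set.indicator_of_notMem (by exact hn), mul_zero]

theorem rate_mul_jumpPMF (hx0 : totalRate q x ≠ 0) (hx : totalRate q x ≠ ∞) (y : E) :
    totalRate q x * jumpPMF q x y = q x y := by
  have h : tsum (q x) ≠ 0 ∧ tsum (q x) ≠ ∞ := ⟨hx0, hx⟩
  rw [jumpPMF, dif_pos h, PMF.normalize_apply, mul_left_comm]
  change q x y * (tsum (q x) * (tsum (q x))⁻¹) = _
  rw [ENNReal.mul_inv_cancel h.1 h.2, mul_one]

variable [MeasurableSpace E] [MeasurableSingletonClass E] [Countable E]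

theorem measurable_jumpTime (q : E → E → ℝ≥0∞) (n : ℕ) : Measurable (jumpTime q n) := by
  unfold jumpTime
  refine Finset.measurable_sum _ fun k _ => ?_
  exact ((measurable_pi_apply k).comp measurable_snd).ennreal_ofReal.div
    ((measurable_of_countable (totalRate q)).comp ((measurable_pi_apply k).comp measurable_fst))

theorem measurable_jumpProcess_uncurry (q : E → E → ℝ≥0∞) :
    Measurable fun z : ℝ × ((ℕ → E) × (ℕ → ℝ)) => jumpProcess q z.1 z.2 := by
  have hS : ∀ n, MeasurableSet {z : ℝ × ((ℕ → E) × (ℕ → ℝ)) |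
      ENNReal.ofReal z.1 < jumpTime q (n + 1) z.2} := fun n =>
    measurableSet_lt measurable_fst.ennreal_ofReal ((measurable_jumpTime q _).comp measurable_snd)
  have hN : Measurable fun z : ℝ × ((ℕ → E) × (ℕ → ℝ)) =>
      sInf {n : ℕ | ENNReal.ofReal z.1 < jumpTime q (n + 1) z.2} := by
    refine measurable_of_Ici fun k => ?_
    -- `k ≤ sInf S` for `k ≥ 1` means that `S` is nonempty and contains no number below `k`
    rcases Nat.eq_zero_or_pos k with rfl | hk
    · simp
    · have : (fun z : ℝ × ((ℕ → E) × (ℕ → ℝ)) =>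
          sInf {n : ℕ | ENNReal.ofReal z.1 < jumpTime q (n + 1) z.2}) ⁻¹' Set.Ici k =
          (⋃ n, {z | ENNReal.ofReal z.1 < jumpTime q (n + 1) z.2}) ∩
          ⋂ n, ⋂ (_ : n < k), {z | ENNReal.ofReal z.1 < jumpTime q (n + 1) z.2}ᶜ := by
        ext z
        simp only [Set.mem_preimage, Set.mem_Ici, Set.mem_inter_iff, Set.mem_iUnion,
          Set.mem_ofPred_eq, Set.mem_iInter, Set.mem_compl_iff]
        constructor
        · intro h
          refine ⟨Nat.nonempty_of_pos_sInf (hk.trans_le h), fun n hn => ?_⟩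
          exact Nat.notMem_of_lt_sInf (hn.trans_le h)
        · rintro ⟨h1, h2⟩
          by_contra! h3
          exact h2 _ h3 (Nat.sInf_mem h1)
      rw [this]
      exact (MeasurableSet.iUnion hS).inter
        (MeasurableSet.iInter fun n => MeasurableSet.iInter fun _ => (hS n).compl)
  have heval : Measurable fun w : (ℕ → E) × ℕ => w.1 w.2 :=
    measurable_from_prod_countable_left fun n => measurable_pi_apply n
  exact heval.comp ((measurable_fst.comp measurable_snd).prodMk hN)

theorem measurable_jumpProcess (q : E → E → ℝ≥0∞) (t : ℝ) : Measurable (jumpProcess q t) :=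
  (measurable_jumpProcess_uncurry q).comp measurable_prodMk_left

theorem measurable_killingClock (q : E → E → ℝ≥0∞) (κ : E → ℝ≥0) (t : ℝ) :
    Measurable (killingClock q κ t) := by
  unfold killingClock
  have : Measurable fun z : ((ℕ → E) × (ℕ → ℝ)) × ℝ => (κ (jumpProcess q z.2 z.1) : ℝ≥0∞) :=
    ((measurable_of_countable fun x => (κ x : ℝ≥0∞)).comp
      (measurable_jumpProcess_uncurry q)).comp measurable_swap
  exact this.lintegral_prod_right'

theorem measurable_discount (q : E → E → ℝ≥0∞) (κ : E → ℝ≥0) (t : ℝ) :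
    Measurable (discount q κ t) :=
  (Real.measurable_exp.comp (measurable_killingClock q κ t).ennreal_toReal.neg).ennreal_ofReal

theorem measurable_truncatedValue (q : E → E → ℝ≥0∞) (κ : E → ℝ≥0) (f : E → ℝ≥0∞) (n : ℕ)
    (t : ℝ) : Measurable (truncatedValue q κ f n t) :=
  (((measurable_of_countable f).comp (measurable_jumpProcess q t)).mul
    (measurable_discount q κ t)).indicator
      (measurableSet_lt measurable_const (measurable_jumpTime q n))

/-- The parameter of the first event (jump or killing) at `x`. -/
noncomputable def eventRate (q : E → E → ℝ≥0∞) (κ : E → ℝ≥0) (x : E) : ℝ≥0 :=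
  (totalRate q x).toNNReal + κ x

/-- The backward equation: the truncated expectations of the jump process are the iterates of the
first-jump equation. -/
theorem lintegral_truncatedValue {K : ℝ≥0} (hκ : ∀ x, κ x ≤ K) (hq : ∀ x, totalRate q x ≠ ∞)
    (n : ℕ) {t : ℝ} (ht : 0 ≤ t) (x : E) :
    ∫⁻ ω, truncatedValue q κ f n t ω ∂(jumpLaw q x) =
      renewalIter q (eventRate q κ) f 0 n t x := by
  induction n generalizing t x with
  | zero =>
    simp [renewalIter, truncatedValue, jumpTime]
  | succ n ih =>
    rw [lintegral_jumpLaw q x (measurable_truncatedValue q κ f (n + 1) t)]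
    simp only [renewalIter]
    by_cases hx0 : totalRate q x = 0
    -- in an absorbing state the holding time is `e / 0 = ∞` because `e > 0` almost surely
    · have hqx : ∀ y, q x y = 0 := ENNReal.tsum_eq_zero.1 hx0
      have hJ : jumpStep q (eventRate q κ) (renewalIter q (eventRate q κ) f 0 n) t x = 0 := by
        simp [jumpStep, hqx]
      rw [hJ, add_zero]
      have h1 : ∀ᵐ e ∂(expMeasure 1), (∑' y, jumpPMF q x y *
          ∫⁻ ω, truncatedValue q κ f (n + 1) t (consSeq x ω.1, consSeq e ω.2) ∂(jumpLaw q y)) =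
          f x * ENNReal.ofReal (Real.exp (-(κ x * t))) := by
        filter_upwards [ae_pos_expMeasure_one] with e he
        have h2 : ENNReal.ofReal t < ENNReal.ofReal e / totalRate q x := by
          rw [hx0, ENNReal.div_zero (by simpa using he)]
          exact ENNReal.ofReal_lt_top
        simp only [truncatedValue_consSeq_of_lt ht n h2, lintegral_const, measure_univ, mul_one]
        rw [ENNReal.tsum_mul_right, PMF.tsum_coe, one_mul]
      rw [lintegral_congr_ae h1]
      simp [eventRate, hx0, mul_comm]
    · set Q : ℝ := (totalRate q x).toReal with hQ
      have hQpos : 0 < Q := ENNReal.toReal_pos hx0 (hq x)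
      have hQr : totalRate q x = ENNReal.ofReal Q := (ENNReal.ofReal_toReal (hq x)).symm
      set R := renewalIter q (eventRate q κ) f 0 n with hR
      have hRm : ∀ y, Measurable fun t => R t y := fun y => measurable_renewalIter n y
      set U : ℝ → ℝ≥0∞ := fun w => ∑' y, jumpPMF q x y * R w y with hU
      have hUm : Measurable U := Measurable.tsum fun y => (hRm y).const_mul _
      set H : ℝ → ℝ≥0∞ := (Set.Iic t).indicator
        fun s => ENNReal.ofReal (Real.exp (-(κ x * s))) * U (t - s) with hH
      have hHm : Measurable H := ((measurable_ofReal_exp_neg _).mul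
        (hUm.comp (measurable_const.sub measurable_id))).indicator measurableSet_Iic
      -- either the first jump comes after `t`, or it comes at time `e / Q ≤ t`
      have h1 : ∀ᵐ e ∂(expMeasure 1), (∑' y, jumpPMF q x y *
          ∫⁻ ω, truncatedValue q κ f (n + 1) t (consSeq x ω.1, consSeq e ω.2) ∂(jumpLaw q y)) =
          (Set.Ioi (Q * t)).indicator (fun _ => f x * ENNReal.ofReal (Real.exp (-(κ x * t)))) e +
            H (e / Q) := by
        filter_upwards [ae_pos_expMeasure_one] with e he
        have hdiv : ENNReal.ofReal e / totalRate q x = ENNReal.ofReal (e / Q) := by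
          rw [hQr, ENNReal.ofReal_div_of_pos hQpos]
        rcases lt_or_ge (Q * t) e with hte | hte
        · have hlt : t < e / Q := by rwa [lt_div_iff₀ hQpos, mul_comm]
          have h2 : ENNReal.ofReal t < ENNReal.ofReal e / totalRate q x := by
            rw [hdiv]
            exact (ENNReal.ofReal_lt_ofReal_iff (ht.trans_lt hlt)).2 hlt
          rw [Set.indicator_of_mem (Set.mem_Ioi.2 hte), hH,
            Set.indicator_of_notMem (by simpa using hlt), add_zero]
          simp only [truncatedValue_consSeq_of_lt ht n h2, lintegral_const, measure_univ, mul_one]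
          rw [ENNReal.tsum_mul_right, PMF.tsum_coe, one_mul]
        · have hle : e / Q ≤ t := by rwa [div_le_iff₀ hQpos, mul_comm]
          have h0 : 0 ≤ e / Q := div_nonneg he.le hQpos.le
          rw [Set.indicator_of_notMem (by simpa using hte), hH,
            Set.indicator_of_mem (Set.mem_Iic.2 hle), zero_add, hU]
          simp only
          rw [← ENNReal.tsum_mul_left]
          refine tsum_congr fun y => ?_
          rw [lintegral_congr fun ω => truncatedValue_consSeq_of_le hκ h0 hle n hdiv,
            lintegral_const_mul _ (measurable_truncatedValue q κ f n _), hR,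
            ih (sub_nonneg.2 hle)]
          ring
      rw [lintegral_congr_ae h1, lintegral_add_left (measurable_const.indicator measurableSet_Ioi),
        lintegral_indicator_const measurableSet_Ioi, expMeasure_one_Ioi (by positivity),
        lintegral_expMeasure_one_div hQpos hHm]
      have hrate : (eventRate q κ x : ℝ) = Q + κ x := by
        rw [eventRate, hQ, NNReal.coe_add]
        rfl
      congr 1
      · rw [hrate, mul_assoc, mul_comm, ← ENNReal.ofReal_mul (Real.exp_nonneg _), ← Real.exp_add]
        congr 3
        ring
      · unfold jumpStep
        have hHe : Measurable fun s => ENNReal.ofReal (Real.exp (-(Q * s))) * H s :=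
          (measurable_ofReal_exp_neg Q).mul hHm
        rw [← lintegral_const_mul _ hHe, ← lintegral_indicator measurableSet_Ioi,
          ← lintegral_indicator measurableSet_Ioc]
        refine lintegral_congr fun s => ?_
        by_cases hs : s ∈ Set.Ioc 0 t
        · rw [Set.indicator_of_mem (Set.mem_Ioi.2 hs.1), Set.indicator_of_mem hs, hH,
            Set.indicator_of_mem (Set.mem_Iic.2 hs.2)]
          have hqR : ∑' y, q x y * R (t - s) y = ENNReal.ofReal Q * U (t - s) := by
            rw [hU, ← ENNReal.tsum_mul_left]
            refine tsum_congr fun y => ?_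
            rw [← rate_mul_jumpPMF hx0 (hq x) y, hQr, mul_assoc]
          have hexp : ENNReal.ofReal (Real.exp (-(eventRate q κ x * s))) =
              ENNReal.ofReal (Real.exp (-(Q * s))) *
                ENNReal.ofReal (Real.exp (-(κ x * s))) := by
            rw [← ENNReal.ofReal_mul (Real.exp_nonneg _), ← Real.exp_add, hrate]
            congr 2
            ring
          rw [hqR, hexp]
          ring
        · rw [Set.indicator_of_notMem hs]
          by_cases hs0 : 0 < s
          · have hts : t < s := by
              by_contra! h
              exact hs ⟨hs0, h⟩
            rw [Set.indicator_of_mem (Set.mem_Ioi.2 hs0), hH,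
              Set.indicator_of_notMem (by simpa using hts), mul_zero, mul_zero]
          · rw [Set.indicator_of_notMem (by simpa using hs0)]

end Path

/-! ### Positivity and comparison from the first-jump equation -/

section Limit

variable {E : Type*} {q : E → E → ℝ≥0∞} {r : E → ℝ≥0} {κ : E → ℝ≥0} {f : E → ℝ≥0∞}

theorem renewalIter_zero_monotone {t : ℝ} (x : E) :
    Monotone fun n => renewalIter q r f 0 n t x := by
  refine monotone_nat_of_le_succ fun n => ?_
  induction n generalizing t x with
  | zero => simp [renewalIter]
  | succ n ih => exact add_le_add le_rfl (jumpStep_mono (fun s _ _ y => ih y) x)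

theorem renewalIter_zero_zero (n : ℕ) (t : ℝ) (x : E) : renewalIter q r 0 0 n t x = 0 := by
  induction n generalizing t x with
  | zero => rfl
  | succ n ih => simp [renewalIter, jumpStep, ih]

/-- In the limit, the mass that reaches `z` by the first jump is a lower bound. -/
theorem jump_le_iSup_renewalIter [Countable E] (x z : E) (t : ℝ) :
    ∫⁻ s in Set.Ioc 0 t, ENNReal.ofReal (Real.exp (-(r x * s))) *
      (q x z * ⨆ n, renewalIter q r f 0 n (t - s) z) ≤ ⨆ n, renewalIter q r f 0 n t x := by
  have h1 : ∀ s, ENNReal.ofReal (Real.exp (-(r x * s))) *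
      (q x z * ⨆ n, renewalIter q r f 0 n (t - s) z) =
      ⨆ n, ENNReal.ofReal (Real.exp (-(r x * s))) * (q x z * renewalIter q r f 0 n (t - s) z) := by
    intro s
    rw [ENNReal.mul_iSup, ENNReal.mul_iSup]
  simp only [h1]
  rw [lintegral_iSup]
  · refine iSup_le fun n => le_trans ?_ (le_iSup _ (n + 1))
    refine le_trans (lintegral_mono fun s => ?_) (le_add_self (b := ENNReal.ofReal
      (Real.exp (-(r x * t))) * f x))
    gcongr
    exact ENNReal.le_tsum (f := fun y => q x y * renewalIter q r f 0 n (t - s) y) z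
  · intro n
    exact (measurable_ofReal_exp_neg _).mul
      (((measurable_renewalIter n z).comp (measurable_const.sub measurable_id)).const_mul _)
  · intro n m hnm s
    simp only
    gcongr
    exact renewalIter_zero_monotone z hnm

theorem exp_mul_le_iSup_renewalIter (x : E) (t : ℝ) :
    ENNReal.ofReal (Real.exp (-(r x * t))) * f x ≤ ⨆ n, renewalIter q r f 0 n t x :=
  le_trans le_self_add (le_iSup (fun n => renewalIter q r f 0 n t x) 1)

theorem iSup_renewalIter_pos_of_rate [Countable E] {x z : E} (hxz : q x z ≠ 0)
    (hz : ∀ t, 0 < t → 0 < ⨆ n, renewalIter q r f 0 n t z) {t : ℝ} (ht : 0 < t) :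
    0 < ⨆ n, renewalIter q r f 0 n t x := by
  refine lt_of_lt_of_le ?_ (jump_le_iSup_renewalIter x z t)
  rw [setLIntegral_congr Ioo_ae_eq_Ioc.symm, setLIntegral_pos_iff]
  · have : Function.support (fun s => ENNReal.ofReal (Real.exp (-(r x * s))) *
        (q x z * ⨆ n, renewalIter q r f 0 n (t - s) z)) ∩ Set.Ioo 0 t = Set.Ioo 0 t := by
      refine Set.inter_eq_right.2 fun s hs => ?_
      rw [Function.mem_support]
      exact mul_ne_zero (by simp [Real.exp_pos])
        (mul_ne_zero hxz (hz _ (by linarith [hs.2])).ne')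
    rw [this]
    simpa using ht
  · exact (measurable_ofReal_exp_neg _).mul ((Measurable.iSup fun n =>
      (measurable_renewalIter n z).comp (measurable_const.sub measurable_id)).const_mul _)

/-- If the limit is antitone in time and bounded by `1`, states joined by a jump are comparable
uniformly in time: up to time `1` the process may have stayed at `x`; later it may have jumped
before time `1`, and restarting from `z` earlier than at time `t` only helps. -/
theorem iSup_renewalIter_comparison [Countable E] {x z : E} (hf : f x = 1) (hxz : q x z ≠ 0)
    (hanti : ∀ s t, 0 ≤ s → s ≤ t →
      ⨆ n, renewalIter q r f 0 n t z ≤ ⨆ n, renewalIter q r f 0 n s z)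
    (hle : ∀ t, 0 ≤ t → ⨆ n, renewalIter q r f 0 n t z ≤ 1) :
    ∃ c : ℝ≥0∞, 0 < c ∧ ∀ t, 0 ≤ t →
      c * ⨆ n, renewalIter q r f 0 n t z ≤ ⨆ n, renewalIter q r f 0 n t x := by
  have hexp : ∀ s : ℝ, s ≤ 1 → ENNReal.ofReal (Real.exp (-(r x : ℝ))) ≤
      ENNReal.ofReal (Real.exp (-(r x * s))) := by
    intro s hs
    refine ENNReal.ofReal_le_ofReal (Real.exp_le_exp.2 (neg_le_neg ?_))
    exact mul_le_of_le_one_right (r x).coe_nonneg hs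
  refine ⟨ENNReal.ofReal (Real.exp (-(r x : ℝ))) * min (q x z) 1, ?_, fun t ht => ?_⟩
  · exact pos_of_ne_zero (mul_ne_zero (by simp [Real.exp_pos]) (by simp [hxz]))
  · rcases le_or_gt t 1 with ht1 | ht1
    · refine le_trans ?_ (exp_mul_le_iSup_renewalIter x t)
      rw [hf, mul_assoc]
      exact mul_le_mul' (hexp t ht1) (mul_le_one' (min_le_right _ _) (hle t ht))
    · refine le_trans ?_ (jump_le_iSup_renewalIter x z t)
      calc _ = ∫⁻ s in Set.Ioc (0 : ℝ) 1, ENNReal.ofReal (Real.exp (-(r x : ℝ))) *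
              (min (q x z) 1 * ⨆ n, renewalIter q r f 0 n t z) := by
            simp [mul_assoc]
        _ ≤ ∫⁻ s in Set.Ioc (0 : ℝ) 1, ENNReal.ofReal (Real.exp (-(r x * s))) *
              (q x z * ⨆ n, renewalIter q r f 0 n (t - s) z) := by
            refine setLIntegral_mono' measurableSet_Ioc fun s hs => ?_
            refine mul_le_mul' (hexp s hs.2) (mul_le_mul' (min_le_left _ _) ?_)
            exact hanti _ _ (by linarith [hs.2]) (by linarith [hs.1])
        _ ≤ _ := lintegral_mono_set (Set.Ioc_subset_Ioc_right ht1.le)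

end Limit

/-! ### Non-explosive processes: killed law and extended generator -/

section NonExplosion

variable {E : Type*} {q : E → E → ℝ≥0∞} {κ : E → ℝ≥0} {f : E → ℝ≥0∞}

/-- The process with rates `q` does not explode: the probability of at least `n` jumps up to time
`t`, given by the first-jump equation, tends to `0`. -/
def NonExplosive (q : E → E → ℝ≥0∞) : Prop :=
  ∀ (x : E) (t : ℝ), 0 ≤ t →
    Filter.Tendsto (fun n => renewalIter q (eventRate q 0) 0 1 n t x) Filter.atTop (𝓝 0)

theorem coe_eventRate_zero (hq : ∀ x, totalRate q x ≠ ∞) (x : E) :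
    (eventRate q 0 x : ℝ≥0∞) = totalRate q x := by
  simp [eventRate, hq x]

theorem nonExplosive_of_lyapunov {V : E → ℝ≥0∞} {c : ℝ≥0} (hV1 : ∀ x, 1 ≤ V x)
    (hVtop : ∀ x, V x ≠ ∞) (hr : ∀ x, totalRate q x ≤ V x)
    (h : ∀ x, ∑' y, q x y * V y ≤ (totalRate q x + c) * V x) : NonExplosive q := by
  intro x t ht
  have hq : ∀ x, totalRate q x ≠ ∞ := fun x => ne_top_of_le_ne_top (hVtop x) (hr x)
  refine tendsto_renewalIter_zero (V := V) (c := c) hV1 hVtop ?_ ?_ ?_ ht x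
  · intro x; rw [coe_eventRate_zero hq]; exact hr x
  · intro x; rw [coe_eventRate_zero hq]; exact le_rfl
  · intro x; rw [coe_eventRate_zero hq]; exact h x

theorem discount_zero (t : ℝ) (ω : (ℕ → E) × (ℕ → ℝ)) : discount q 0 t ω = 1 := by
  simp [discount, killingClock]

theorem truncatedValue_monotone (t : ℝ) (ω : (ℕ → E) × (ℕ → ℝ)) :
    Monotone fun n => truncatedValue q κ f n t ω := by
  intro n m hnm
  refine Set.indicator_le_indicator_apply_of_subset ?_ zero_le
  intro ω h
  exact lt_of_lt_of_le (by exact h) (jumpTime_mono q ω hnm)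

theorem killed_mem_eq (q : E → E → ℝ≥0∞) (κ : E → ℝ≥0) (t : ℝ) (B : Set E) :
    {ω : ((ℕ → E) × (ℕ → ℝ)) × ℝ | ∃ y ∈ B, killed (jumpProcess q) κ t ω = some y} =
      {ω | jumpProcess q t ω.1 ∈ B ∧ killingClock q κ t ω.1 < ENNReal.ofReal ω.2} := by
  ext ω
  simp only [Set.mem_ofPred_eq, killed, killingClock]
  split_ifs with h
  · simp [h]
  · simp [h]

variable [MeasurableSpace E] [MeasurableSingletonClass E] [Countable E]

theorem NonExplosive.ae_exists_lt_jumpTime (hne : NonExplosive q) (hq : ∀ x, totalRate q x ≠ ∞)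
    {t : ℝ} (ht : 0 ≤ t) (x : E) :
    ∀ᵐ ω ∂(jumpLaw q x), ∃ n, ENNReal.ofReal t < jumpTime q n ω := by
  have h1 : ∀ n, jumpLaw q x {ω | ENNReal.ofReal t < jumpTime q n ω} +
      renewalIter q (eventRate q 0) 0 1 n t x = 1 := by
    intro n
    have hd := renewalIter_dynkin (q := q) (r := eventRate q 0) (V := 1) (a := 0) (b := 0)
      (fun x => by rw [coe_eventRate_zero hq]; simp [totalRate]) n ht x
    have hm : MeasurableSet {ω | ENNReal.ofReal t < jumpTime q n ω} :=
      measurableSet_lt measurable_const (measurable_jumpTime q n)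
    have hW := lintegral_truncatedValue (q := q) (κ := 0) (f := 1) (K := 0) (fun _ => le_rfl) hq n
      ht x
    simp only [truncatedValue, discount_zero, Pi.one_apply, mul_one] at hW
    rw [lintegral_indicator_const hm, one_mul] at hW
    rw [hW, ← renewalIter_add]
    simpa [renewalIter_zero_zero] using hd
  have h2 : ∀ n, jumpLaw q x {ω | ¬ ∃ n, ENNReal.ofReal t < jumpTime q n ω} ≤
      renewalIter q (eventRate q 0) 0 1 n t x := by
    intro n
    have hm : MeasurableSet {ω | ENNReal.ofReal t < jumpTime q n ω} :=
      measurableSet_lt measurable_const (measurable_jumpTime q n)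
    calc _ ≤ jumpLaw q x {ω | ENNReal.ofReal t < jumpTime q n ω}ᶜ :=
          measure_mono fun ω hω h => absurd (⟨n, h⟩ : ∃ n, ENNReal.ofReal t < jumpTime q n ω) hω
      _ = 1 - jumpLaw q x {ω | ENNReal.ofReal t < jumpTime q n ω} := prob_compl_eq_one_sub hm
      _ ≤ _ := by rw [tsub_le_iff_left, h1]
  exact le_antisymm (ge_of_tendsto' (hne x t ht) h2) zero_le

/-- Without explosion, expectations of the process at a fixed time are the limits of the iterates of
the first-jump equation. -/
theorem NonExplosive.tendsto_renewalIter (hne : NonExplosive q) {K : ℝ≥0} (hκ : ∀ x, κ x ≤ K)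
    (hq : ∀ x, totalRate q x ≠ ∞) {t : ℝ} (ht : 0 ≤ t) (x : E) :
    Filter.Tendsto (fun n => renewalIter q (eventRate q κ) f 0 n t x) Filter.atTop
      (𝓝 (∫⁻ ω, f (jumpProcess q t ω) * discount q κ t ω ∂(jumpLaw q x))) := by
  simp only [← lintegral_truncatedValue hκ hq _ ht]
  refine lintegral_tendsto_of_tendsto_of_monotone
    (fun n => (measurable_truncatedValue q κ f n t).aemeasurable)
    (Filter.Eventually.of_forall fun ω => truncatedValue_monotone t ω) ?_
  filter_upwards [hne.ae_exists_lt_jumpTime hq ht x] with ω ⟨N, hN⟩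
  refine tendsto_const_nhds.congr' ?_
  filter_upwards [Filter.eventually_ge_atTop N] with n hn
  rw [truncatedValue, Set.indicator_of_mem]
  exact hN.trans_le (jumpTime_mono q ω hn)

theorem NonExplosive.iSup_renewalIter (hne : NonExplosive q) {K : ℝ≥0} (hκ : ∀ x, κ x ≤ K)
    (hq : ∀ x, totalRate q x ≠ ∞) {t : ℝ} (ht : 0 ≤ t) (x : E) :
    ⨆ n, renewalIter q (eventRate q κ) f 0 n t x =
      ∫⁻ ω, f (jumpProcess q t ω) * discount q κ t ω ∂(jumpLaw q x) :=
  iSup_eq_of_tendsto (renewalIter_zero_monotone x) (hne.tendsto_renewalIter hκ hq ht x)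

theorem NonExplosive.measure_jumpProcess_mem (hne : NonExplosive q)
    (hq : ∀ x, totalRate q x ≠ ∞) {t : ℝ} (ht : 0 ≤ t) (x : E) (B : Set E) :
    jumpLaw q x {ω | jumpProcess q t ω ∈ B} =
      ⨆ n, renewalIter q (eventRate q 0) (B.indicator 1) 0 n t x := by
  rw [hne.iSup_renewalIter (κ := 0) (K := 0) (fun _ => le_rfl) hq ht]
  simp only [discount_zero, mul_one]
  have hB : MeasurableSet {ω | jumpProcess q t ω ∈ B} :=
    measurable_jumpProcess q t (Set.to_countable B).measurableSet
  rw [← lintegral_indicator_one hB]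
  rfl

theorem measurableSet_killed_mem (q : E → E → ℝ≥0∞) (κ : E → ℝ≥0) (t : ℝ) (B : Set E) :
    MeasurableSet {ω | ∃ y ∈ B, killed (jumpProcess q) κ t ω = some y} := by
  rw [killed_mem_eq]
  exact ((Set.to_countable B).measurableSet.preimage
      ((measurable_jumpProcess q t).comp measurable_fst)).inter
      (measurableSet_lt ((measurable_killingClock q κ t).comp measurable_fst)
        measurable_snd.ennreal_ofReal)

/-- The law of the killed process: integrating out the exponential killing time discounts the path
by `exp (- ∫_0^t κ (X_s) ds)`. -/
theorem killedLaw_mem {K : ℝ≥0} (hκ : ∀ x, κ x ≤ K) (t : ℝ) (x : E) (B : Set E) :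
    killedLaw (jumpLaw q) x {ω | ∃ y ∈ B, killed (jumpProcess q) κ t ω = some y} =
      ∫⁻ ω, B.indicator 1 (jumpProcess q t ω) * discount q κ t ω ∂(jumpLaw q x) := by
  have hm := measurableSet_killed_mem q κ t B
  rw [killed_mem_eq] at hm
  rw [killed_mem_eq, killedLaw, Measure.prod_apply hm]
  refine lintegral_congr fun ω => ?_
  by_cases hB : jumpProcess q t ω ∈ B
  · have : Prod.mk ω ⁻¹' {ω : ((ℕ → E) × (ℕ → ℝ)) × ℝ |
        jumpProcess q t ω.1 ∈ B ∧ killingClock q κ t ω.1 < ENNReal.ofReal ω.2} =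
        Set.Ioi (killingClock q κ t ω).toReal := by
      ext z
      simp only [Set.mem_preimage, Set.mem_ofPred_eq, hB, true_and, Set.mem_Ioi]
      exact ENNReal.lt_ofReal_iff_toReal_lt (killingClock_ne_top hκ t ω)
    rw [this, expMeasure_one_Ioi ENNReal.toReal_nonneg, Set.indicator_of_mem hB]
    simp [discount]
  · have : Prod.mk ω ⁻¹' {ω : ((ℕ → E) × (ℕ → ℝ)) × ℝ |
        jumpProcess q t ω.1 ∈ B ∧ killingClock q κ t ω.1 < ENNReal.ofReal ω.2} = ∅ := by
      ext z
      simp [hB]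
    rw [this, Set.indicator_of_notMem hB]
    simp

theorem NonExplosive.killedLaw_mem_eq_iSup (hne : NonExplosive q) {K : ℝ≥0} (hκ : ∀ x, κ x ≤ K)
    (hq : ∀ x, totalRate q x ≠ ∞) {t : ℝ} (ht : 0 ≤ t) (x : E) (B : Set E) :
    killedLaw (jumpLaw q) x {ω | ∃ y ∈ B, killed (jumpProcess q) κ t ω = some y} =
      ⨆ n, renewalIter q (eventRate q κ) (B.indicator 1) 0 n t x := by
  rw [killedLaw_mem hκ, hne.iSup_renewalIter hκ hq ht]

/-- The expectation of `f` at time `t`. -/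
noncomputable def transition (q : E → E → ℝ≥0∞) (f : E → ℝ≥0∞) (t : ℝ) (x : E) : ℝ≥0∞ :=
  ∫⁻ ω, f (jumpProcess q t ω) ∂(jumpLaw q x)

theorem measurable_transition (f : E → ℝ≥0∞) (x : E) : Measurable fun t => transition q f t x := by
  have : Measurable fun z : ℝ × ((ℕ → E) × (ℕ → ℝ)) => f (jumpProcess q z.1 z.2) :=
    (measurable_of_countable f).comp (measurable_jumpProcess_uncurry q)
  exact this.lintegral_prod_right'

theorem transition_mono {g : E → ℝ≥0∞} (h : ∀ x, f x ≤ g x) (t : ℝ) (x : E) :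
    transition q f t x ≤ transition q g t x :=
  lintegral_mono fun _ => h _

theorem transition_const_mul (c : ℝ≥0∞) (t : ℝ) (x : E) :
    transition q (fun x => c * f x) t x = c * transition q f t x :=
  lintegral_const_mul _ ((measurable_of_countable f).comp (measurable_jumpProcess q t))

theorem transition_tendsto_of_monotone {f : ℕ → E → ℝ≥0∞} {g : E → ℝ≥0∞}
    (hf : ∀ x, Monotone fun k => f k x)
    (hg : ∀ x, Filter.Tendsto (fun k => f k x) Filter.atTop (𝓝 (g x))) (t : ℝ) (x : E) :
    Filter.Tendsto (fun k => transition q (f k) t x) Filter.atTop (𝓝 (transition q g t x)) :=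
  lintegral_tendsto_of_tendsto_of_monotone
    (fun k => ((measurable_of_countable (f k)).comp (measurable_jumpProcess q t)).aemeasurable)
    (Filter.Eventually.of_forall fun _ => hf _) (Filter.Eventually.of_forall fun _ => hg _)

theorem tendsto_setLIntegral_transition {f : ℕ → E → ℝ≥0∞} {g : E → ℝ≥0∞}
    (hf : ∀ x, Monotone fun k => f k x)
    (hg : ∀ x, Filter.Tendsto (fun k => f k x) Filter.atTop (𝓝 (g x))) (t : ℝ) (x : E) :
    Filter.Tendsto (fun k => ∫⁻ s in Set.Ioc 0 t, transition q (f k) s x) Filter.atTop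
      (𝓝 (∫⁻ s in Set.Ioc 0 t, transition q g s x)) :=
  lintegral_tendsto_of_tendsto_of_monotone
    (fun k => (measurable_transition (f k) x).aemeasurable)
    (Filter.Eventually.of_forall fun s _ _ h => transition_mono (fun x => hf x h) s x)
    (Filter.Eventually.of_forall fun s => transition_tendsto_of_monotone hf hg s x)

theorem NonExplosive.tendsto_transition (hne : NonExplosive q) (hq : ∀ x, totalRate q x ≠ ∞)
    (f : E → ℝ≥0∞) {t : ℝ} (ht : 0 ≤ t) (x : E) :
    Filter.Tendsto (fun n => renewalIter q (eventRate q 0) f 0 n t x) Filter.atTop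
      (𝓝 (transition q f t x)) := by
  simpa [discount_zero, transition] using
    hne.tendsto_renewalIter (κ := 0) (K := 0) (f := f) (fun _ => le_rfl) hq ht x

theorem NonExplosive.transition_le (hne : NonExplosive q) (hq : ∀ x, totalRate q x ≠ ∞)
    {V : E → ℝ≥0∞} {c : ℝ≥0} (h : ∀ x, ∑' y, q x y * V y ≤ (totalRate q x + c) * V x)
    {t : ℝ} (ht : 0 ≤ t) (x : E) :
    transition q V t x ≤ ENNReal.ofReal (Real.exp (c * t)) * V x := by
  refine le_of_tendsto' (hne.tendsto_transition hq V ht x) fun n => ?_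
  refine (renewalIter_mono (fun _ => le_rfl) (fun _ => zero_le) n t x).trans
    (renewalIter_le_exp (c := c) (fun x => ?_) n ht x)
  rw [coe_eventRate_zero hq]
  exact h x

/-- Dynkin's formula for a bounded function. -/
theorem NonExplosive.dynkin_of_bounded (hne : NonExplosive q) (hq : ∀ x, totalRate q x ≠ ∞)
    {V : E → ℝ≥0∞} {k : ℝ≥0} (hV : ∀ x, V x ≤ k) {t : ℝ} (ht : 0 ≤ t) (x : E) :
    transition q V t x +
      ∫⁻ s in Set.Ioc 0 t, transition q (fun x => ∑' y, q x y * (V x - V y)) s x =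
    V x + ∫⁻ s in Set.Ioc 0 t, transition q (fun x => ∑' y, q x y * (V y - V x)) s x := by
  set a : E → ℝ≥0∞ := fun x => ∑' y, q x y * (V x - V y) with ha
  set b : E → ℝ≥0∞ := fun x => ∑' y, q x y * (V y - V x) with hb
  have hab : ∀ x, ∑' y, q x y * V y + a x = eventRate q 0 x * V x + b x := by
    intro x
    rw [coe_eventRate_zero hq, totalRate, ha, hb, ← ENNReal.tsum_mul_right, ← ENNReal.tsum_add,
      ← ENNReal.tsum_add]
    refine tsum_congr fun y => ?_
    rw [← mul_add, ← mul_add, add_tsub_eq_max, add_tsub_eq_max, max_comm]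
  have hint : ∀ f : E → ℝ≥0∞, Filter.Tendsto
      (fun n => ∫⁻ s in Set.Ioc 0 t, renewalIter q (eventRate q 0) f 0 n s x) Filter.atTop
      (𝓝 (∫⁻ s in Set.Ioc 0 t, transition q f s x)) := fun f =>
    lintegral_tendsto_of_tendsto_of_monotone
      (fun n => (measurable_renewalIter n x).aemeasurable)
      (Filter.Eventually.of_forall fun s => renewalIter_zero_monotone x)
      (ae_restrict_of_forall_mem measurableSet_Ioc fun s hs =>
        hne.tendsto_transition hq f hs.1.le x)
  -- the contribution of the paths with at least `n` jumps vanishes because `V` is bounded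
  have hrest : Filter.Tendsto (fun n => renewalIter q (eventRate q 0) 0 V n t x) Filter.atTop
      (𝓝 0) := by
    have h1 := ENNReal.Tendsto.const_mul (a := (k : ℝ≥0∞)) (hne x t ht) (Or.inr ENNReal.coe_ne_top)
    rw [mul_zero] at h1
    refine tendsto_of_tendsto_of_tendsto_of_le_of_le tendsto_const_nhds h1
      (fun _ => zero_le) fun n => ?_
    rw [← renewalIter_const_mul]
    exact renewalIter_mono (fun _ => zero_le) (fun x => by simpa using hV x) n t x
  have hL := ((hne.tendsto_transition hq V ht x).add hrest).add (hint a)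
  have hR := (tendsto_const_nhds (x := V x)).add (hint b)
  rw [add_zero] at hL
  refine tendsto_nhds_unique hL (hR.congr fun n => ?_)
  rw [← renewalIter_add]
  exact (renewalIter_dynkin hab n ht x).symm

/-- Truncating both terms at the level `k` makes their truncated difference increase with `k`. -/
theorem min_tsub_min_monotone (a b : ℝ≥0∞) :
    Monotone fun k : ℕ => min a (k : ℝ≥0∞) - min b (k : ℝ≥0∞) := by
  intro k l hkl
  have hkl' : (k : ℝ≥0∞) ≤ l := by exact_mod_cast hkl
  simp only
  rw [tsub_le_iff_right]
  rcases le_or_gt (k : ℝ≥0∞) b with h | h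
  · rw [min_eq_right h]
    exact (min_le_right _ _).trans le_add_self
  · rw [min_eq_left h.le]
    refine le_trans (min_le_min_left _ hkl') ?_
    rw [min_eq_left (h.le.trans hkl')]
    exact le_tsub_add

theorem eventually_min_natCast_eq {a : ℝ≥0∞} (ha : a ≠ ∞) :
    ∀ᶠ k : ℕ in Filter.atTop, min a (k : ℝ≥0∞) = a := by
  obtain ⟨N, hN⟩ := ENNReal.exists_nat_gt ha
  filter_upwards [Filter.eventually_ge_atTop N] with k hk
  exact min_eq_left (hN.le.trans (by exact_mod_cast hk))

/-- Dynkin's formula for a nonnegative function, by monotone convergence along the truncations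
`min V k`: the increments `(V x - V y)⁺` and `(V y - V x)⁺` of the truncations increase with `k`. -/
theorem NonExplosive.dynkin (hne : NonExplosive q) (hq : ∀ x, totalRate q x ≠ ∞)
    {V : E → ℝ≥0∞} (hV : ∀ x, V x ≠ ∞) {t : ℝ} (ht : 0 ≤ t) (x : E) :
    transition q V t x +
      ∫⁻ s in Set.Ioc 0 t, transition q (fun x => ∑' y, q x y * (V x - V y)) s x =
    V x + ∫⁻ s in Set.Ioc 0 t, transition q (fun x => ∑' y, q x y * (V y - V x)) s x := by
  have hmono : ∀ x, Monotone fun k : ℕ => min (V x) (k : ℝ≥0∞) := fun x k l h =>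
    min_le_min_left _ (by exact_mod_cast h)
  have hlim : ∀ x, Filter.Tendsto (fun k : ℕ => min (V x) (k : ℝ≥0∞)) Filter.atTop (𝓝 (V x)) :=
    fun x => tendsto_const_nhds.congr' ((eventually_min_natCast_eq (hV x)).mono fun _ h => h.symm)
  have hsum_mono : ∀ (x : E) (u v : E → ℝ≥0∞), Monotone fun k : ℕ =>
      ∑' y, q x y * (min (u y) (k : ℝ≥0∞) - min (v y) (k : ℝ≥0∞)) := fun x u v k l h =>
    ENNReal.tsum_le_tsum fun y => mul_le_mul_right (min_tsub_min_monotone _ _ h) _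
  have hsum_lim : ∀ (x : E) (u v : E → ℝ≥0∞), (∀ y, u y ≠ ∞) → (∀ y, v y ≠ ∞) →
      Filter.Tendsto (fun k : ℕ =>
        ∑' y, q x y * (min (u y) (k : ℝ≥0∞) - min (v y) (k : ℝ≥0∞))) Filter.atTop
        (𝓝 (∑' y, q x y * (u y - v y))) := by
    intro x u v hu hv
    simp only [← lintegral_count]
    refine lintegral_tendsto_of_tendsto_of_monotone
      (fun k => (measurable_of_countable _).aemeasurable)
      (Filter.Eventually.of_forall fun y k l h =>
        mul_le_mul_right (min_tsub_min_monotone _ _ h) _)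
      (Filter.Eventually.of_forall fun y => tendsto_const_nhds.congr' ?_)
    filter_upwards [eventually_min_natCast_eq (hu y), eventually_min_natCast_eq (hv y)] with k h1 h2
    rw [h1, h2]
  have hb := fun k : ℕ => hne.dynkin_of_bounded hq (V := fun x => min (V x) (k : ℝ≥0∞))
    (k := (k : ℝ≥0)) (fun x => by simp) ht x
  have hL := (transition_tendsto_of_monotone (q := q) hmono hlim t x).add
    (tendsto_setLIntegral_transition (q := q) (fun z => hsum_mono z (fun _ => V z) V)
      (fun z => hsum_lim z (fun _ => V z) V (fun _ => hV z) hV) t x)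
  have hR := (hlim x).add
    (tendsto_setLIntegral_transition (q := q) (fun z => hsum_mono z V fun _ => V z)
      (fun z => hsum_lim z V (fun _ => V z) hV fun _ => hV z) t x)
  exact tendsto_nhds_unique hL (hR.congr fun k => (hb k).symm)

/-- A nonnegative function whose mean rates of increase and of decrease are at most `C V` belongs to
the extended domain of the generator, with image the difference of these rates. The bound makes
`E_x V (X_s)` grow at most exponentially, so all terms of Dynkin's formula are finite and may be
subtracted. -/
theorem NonExplosive.isExtendedGenerator (hne : NonExplosive q) (hq : ∀ x, totalRate q x ≠ ∞)
    {V : E → ℝ} (hV0 : ∀ x, 0 ≤ V x) {C : ℝ≥0}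
    (ha : ∀ x, ∑' y, q x y * (ENNReal.ofReal (V x) - ENNReal.ofReal (V y)) ≤
      C * ENNReal.ofReal (V x))
    (hb : ∀ x, ∑' y, q x y * (ENNReal.ofReal (V y) - ENNReal.ofReal (V x)) ≤
      C * ENNReal.ofReal (V x)) :
    IsExtendedGenerator (jumpLaw q) (jumpProcess q) V fun x =>
      (∑' y, q x y * (ENNReal.ofReal (V y) - ENNReal.ofReal (V x))).toReal -
      (∑' y, q x y * (ENNReal.ofReal (V x) - ENNReal.ofReal (V y))).toReal := by
  set W : E → ℝ≥0∞ := fun x => ENNReal.ofReal (V x) with hW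
  have hWtop : ∀ x, W x ≠ ∞ := fun x => ENNReal.ofReal_ne_top
  set a : E → ℝ≥0∞ := fun x => ∑' y, q x y * (W x - W y) with ha'
  set b : E → ℝ≥0∞ := fun x => ∑' y, q x y * (W y - W x) with hb'
  have hatop : ∀ x, a x ≠ ∞ := fun x =>
    ne_top_of_le_ne_top (ENNReal.mul_ne_top ENNReal.coe_ne_top (hWtop x)) (ha x)
  have hbtop : ∀ x, b x ≠ ∞ := fun x =>
    ne_top_of_le_ne_top (ENNReal.mul_ne_top ENNReal.coe_ne_top (hWtop x)) (hb x)
  refine ⟨measurable_of_countable _, measurable_of_countable _, fun x t ht => ?_⟩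
  have hgrow : ∀ s, 0 ≤ s → transition q W s x ≤ ENNReal.ofReal (Real.exp (C * s)) * W x := by
    intro s hs
    refine hne.transition_le hq (fun x => ?_) hs x
    calc ∑' y, q x y * W y ≤ ∑' y, (q x y * W x + q x y * (W y - W x)) := by
          refine ENNReal.tsum_le_tsum fun y => ?_
          rw [← mul_add]
          exact mul_le_mul_right le_add_tsub _
      _ = totalRate q x * W x + b x := by
          rw [ENNReal.tsum_add, ENNReal.tsum_mul_right, totalRate]
      _ ≤ _ := by
          rw [add_mul]
          exact add_le_add le_rfl (hb x)
  have hfin : ∀ f : E → ℝ≥0∞, (∀ x, f x ≤ C * W x) →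
      ∫⁻ s in Set.Ioc 0 t, transition q f s x ≠ ∞ := by
    intro f hf
    refine ne_top_of_le_ne_top (b := ∫⁻ s in Set.Ioc 0 t,
      C * (ENNReal.ofReal (Real.exp (C * t)) * W x)) ?_ ?_
    · rw [setLIntegral_const]
      exact ENNReal.mul_ne_top (ENNReal.mul_ne_top ENNReal.coe_ne_top
        (ENNReal.mul_ne_top ENNReal.ofReal_ne_top (hWtop x))) (by simp)
    · refine setLIntegral_mono' measurableSet_Ioc fun s hs => ?_
      refine (transition_mono hf s x).trans ?_
      rw [transition_const_mul]
      refine mul_le_mul_right ((hgrow s hs.1.le).trans ?_) _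
      gcongr
      exact hs.2
  have hfa := hfin a ha
  have hfb := hfin b hb
  have hmj := measurable_jumpProcess_uncurry q
  -- both parts of the generator as functions on the product of the path space and `(0, t]`
  set μ := (jumpLaw q x).prod (volume.restrict (Set.Ioc 0 t)) with hμ
  have hprod : ∀ f : E → ℝ≥0∞, ∫⁻ z, f (jumpProcess q z.2 z.1) ∂μ =
      ∫⁻ s in Set.Ioc 0 t, transition q f s x := by
    intro f
    have hm : Measurable fun z : ((ℕ → E) × (ℕ → ℝ)) × ℝ => f (jumpProcess q z.2 z.1) :=
      ((measurable_of_countable f).comp hmj).comp measurable_swap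
    rw [hμ, lintegral_prod_symm _ hm.aemeasurable]
    rfl
  have hmf : ∀ f : E → ℝ≥0∞, Measurable fun z : ((ℕ → E) × (ℕ → ℝ)) × ℝ =>
      f (jumpProcess q z.2 z.1) := fun f =>
    ((measurable_of_countable f).comp hmj).comp measurable_swap
  have hintf : ∀ f : E → ℝ≥0∞, ∫⁻ s in Set.Ioc 0 t, transition q f s x ≠ ∞ →
      Integrable (fun z => (f (jumpProcess q z.2 z.1)).toReal) μ := fun f hf =>
    integrable_toReal_of_lintegral_ne_top (hmf f).aemeasurable (by rwa [hprod])
  have hvalf : ∀ f : E → ℝ≥0∞, (∀ x, f x ≠ ∞) →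
      ∫ z, (f (jumpProcess q z.2 z.1)).toReal ∂μ =
        (∫⁻ s in Set.Ioc 0 t, transition q f s x).toReal := by
    intro f hf
    rw [integral_toReal (hmf f).aemeasurable
      (Filter.Eventually.of_forall fun z => (hf _).lt_top), hprod]
  have hWt : transition q W t x ≠ ∞ := ne_top_of_le_ne_top
    (ENNReal.mul_ne_top ENNReal.ofReal_ne_top (hWtop x)) (hgrow t ht.le)
  have hVeq : ∀ ω, V (jumpProcess q t ω) = (W (jumpProcess q t ω)).toReal := fun ω =>
    (ENNReal.toReal_ofReal (hV0 _)).symm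
  have hmW : Measurable fun ω => W (jumpProcess q t ω) :=
    (measurable_of_countable W).comp (measurable_jumpProcess q t)
  refine ⟨?_, ?_, ?_⟩
  · simp only [hVeq]
    exact integrable_toReal_of_lintegral_ne_top hmW.aemeasurable hWt
  · refine lt_of_le_of_lt (b := ∫⁻ s in Set.Ioc 0 t, transition q (fun x => b x + a x) s x) ?_ ?_
    · refine lintegral_mono fun s => lintegral_mono fun ω => ?_
      refine (enorm_sub_le).trans (add_le_add ?_ ?_)
      · rw [Real.enorm_of_nonneg ENNReal.toReal_nonneg, ENNReal.ofReal_toReal (hbtop _)]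
      · rw [Real.enorm_of_nonneg ENNReal.toReal_nonneg, ENNReal.ofReal_toReal (hatop _)]
    · have : ∀ s, transition q (fun x => b x + a x) s x =
          transition q b s x + transition q a s x := fun s =>
        lintegral_add_left ((measurable_of_countable b).comp (measurable_jumpProcess q s)) _
      simp only [this]
      rw [lintegral_add_left (measurable_transition b x)]
      exact (ENNReal.add_ne_top.2 ⟨hfb, hfa⟩).lt_top
  · have hd := hne.dynkin hq hWtop ht.le x
    have h1 : ∫ ω, (∫ s in (0 : ℝ)..t, ((b (jumpProcess q s ω)).toReal -
        (a (jumpProcess q s ω)).toReal)) ∂(jumpLaw q x) =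
        (∫⁻ s in Set.Ioc 0 t, transition q b s x).toReal -
        (∫⁻ s in Set.Ioc 0 t, transition q a s x).toReal := by
      simp only [intervalIntegral.integral_of_le ht.le]
      rw [← hvalf a hatop, ← hvalf b hbtop, ← integral_sub (hintf b hfb) (hintf a hfa)]
      exact (integral_prod _ ((hintf b hfb).sub (hintf a hfa))).symm
    rw [h1]
    simp only [hVeq]
    rw [integral_toReal hmW.aemeasurable (Filter.Eventually.of_forall fun ω => (hWtop _).lt_top)]
    have hd' := congrArg ENNReal.toReal hd
    rw [ENNReal.toReal_add hWt hfa, ENNReal.toReal_add (hWtop x) hfb, hW,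
      ENNReal.toReal_ofReal (hV0 x)] at hd'
    change (transition q W t x).toReal = _
    linarith

end NonExplosion

/-! ### The generator applied to a power -/

section Reproduction

/-- The contribution to the generator at `x`, applied to `y ^ α`, of the replacement of one of the
`x` individuals by `k` children, before multiplication by the probability of `k`. -/
noncomputable def powerGain (α x k : ℝ) : ℝ := x * ((x + k - 1) ^ α - x ^ α)

theorem powerGain_eq {α x k : ℝ} (hx : 1 ≤ x) (hk : 0 ≤ k) :
    powerGain α x k = x ^ α * (x * ((1 + (k - 1) / x) ^ α - 1)) := by
  have hx0 : 0 < x := by linarith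
  have h1 : -1 ≤ (k - 1) / x := by rw [le_div_iff₀ hx0]; nlinarith
  have h2 : x + k - 1 = x * (1 + (k - 1) / x) := by field_simp; ring
  rw [powerGain, h2, Real.mul_rpow hx0.le (by linarith)]
  ring

/-- The relative gain lies between the tangent and the chord of the convex function `y ^ α`. -/
theorem relative_gain_bounds {α x k : ℝ} (hα : 1 ≤ α) (hx : 1 ≤ x) (hk : 0 ≤ k) :
    α * (k - 1) ≤ x * ((1 + (k - 1) / x) ^ α - 1) ∧
      x * ((1 + (k - 1) / x) ^ α - 1) ≤ k ^ α - 1 := by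
  have hx0 : 0 < x := by linarith
  have h1 : -1 ≤ (k - 1) / x := by rw [le_div_iff₀ hx0]; nlinarith
  constructor
  · have h := one_add_mul_self_le_rpow_one_add h1 hα
    calc α * (k - 1) = x * (1 + α * ((k - 1) / x) - 1) := by field_simp; ring
      _ ≤ _ := by gcongr
  · have h := (convexOn_rpow hα).2 (Set.mem_Ici.2 zero_le_one) (Set.mem_Ici.2 hk)
      (show 0 ≤ 1 - 1 / x by rw [sub_nonneg, div_le_one hx0]; exact hx)
      (show 0 ≤ 1 / x by positivity) (by ring)
    have h3 : (1 - 1 / x) • (1 : ℝ) + (1 / x) • k = 1 + (k - 1) / x := by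
      simp only [smul_eq_mul]; ring
    rw [h3] at h
    simp only [smul_eq_mul, Real.one_rpow] at h
    calc x * ((1 + (k - 1) / x) ^ α - 1) ≤ x * (((1 - 1 / x) * 1 + 1 / x * k ^ α) - 1) := by
          gcongr
      _ = _ := by field_simp; ring

theorem abs_powerGain_le {α x k : ℝ} (hα : 1 ≤ α) (hx : 1 ≤ x) (hk : 0 ≤ k) :
    |powerGain α x k| ≤ x ^ α * (k ^ α + α) := by
  obtain ⟨h1, h2⟩ := relative_gain_bounds hα hx hk
  have hk' : 0 ≤ k ^ α := Real.rpow_nonneg hk α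
  rw [powerGain_eq hx hk, abs_mul, abs_of_nonneg (Real.rpow_nonneg (by linarith) α)]
  refine mul_le_mul_of_nonneg_left (abs_le.2 ⟨?_, by linarith⟩)
    (Real.rpow_nonneg (by linarith) α)
  nlinarith

theorem tendsto_relative_gain {α : ℝ} (hα : 1 ≤ α) (k : ℝ) :
    Filter.Tendsto (fun x : ℕ => (x : ℝ) * ((1 + (k - 1) / x) ^ α - 1)) Filter.atTop
      (𝓝 (α * (k - 1))) := by
  have hd : HasDerivAt (fun s : ℝ => (1 + (k - 1) * s) ^ α) (α * (k - 1)) 0 := by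
    have h1 : HasDerivAt (fun s : ℝ => 1 + (k - 1) * s) (k - 1) 0 := by
      simpa using ((hasDerivAt_id (0 : ℝ)).const_mul (k - 1)).const_add 1
    have h2 := h1.rpow_const (p := α) (Or.inr hα)
    simpa [mul_comm] using h2
  have h3 := hd.tendsto_slope_zero_right
  have h4 : Filter.Tendsto (fun x : ℕ => ((x : ℝ))⁻¹) Filter.atTop (𝓝[>] 0) :=
    tendsto_inv_atTop_nhdsGT_zero.comp tendsto_natCast_atTop_atTop
  refine (h3.comp h4).congr fun x => ?_
  simp [div_eq_mul_inv]

variable {p : PMF ℕ} {m α : ℝ}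

theorem hasSum_toReal (p : PMF ℕ) : HasSum (fun n => (p n).toReal) 1 := by
  have h := p.tsum_coe
  have hs : Summable fun n => (p n).toReal := ENNReal.summable_toReal (by simp [h])
  rw [hs.hasSum_iff, ← ENNReal.tsum_toReal_eq fun n => p.apply_ne_top n, h, ENNReal.toReal_one]

/-- Since `n ≥ 1` for `n ≠ 0`, the mean is at least the mass off `0`. -/
theorem one_sub_mean_le (hm : HasSum (fun n : ℕ => (n : ℝ) * (p n).toReal) m) :
    1 - m ≤ (p 0).toReal := by
  have h := (hasSum_toReal p).sub hm
  have h0 : HasSum (fun n : ℕ => if n = 0 then (p 0).toReal else 0) (p 0).toReal :=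
    hasSum_ite_eq 0 _
  refine hasSum_le (fun n => ?_) h h0
  split_ifs with hn
  · simp [hn]
  · have h1 : (1 : ℝ) ≤ n := by exact_mod_cast Nat.one_le_iff_ne_zero.2 hn
    have h2 : 0 ≤ (p n).toReal := ENNReal.toReal_nonneg
    nlinarith

theorem summable_dominating (hpα : Summable fun n : ℕ => (n : ℝ) ^ α * (p n).toReal) :
    Summable fun k : ℕ => (p k).toReal * ((k : ℝ) ^ α + α) := by
  refine (hpα.add ((hasSum_toReal p).summable.mul_left α)).congr fun k => ?_
  ring

/-- A constant `C` such that the mean rates of increase and of decrease of `x ^ α` are both at most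
`C x ^ α`. -/
noncomputable def gainBound (p : PMF ℕ) (α : ℝ) : ℝ := ∑' k : ℕ, (p k).toReal * ((k : ℝ) ^ α + α)

theorem summable_powerGain (hα : 1 ≤ α)
    (hpα : Summable fun n : ℕ => (n : ℝ) ^ α * (p n).toReal) {x : ℝ} (hx : 1 ≤ x) :
    Summable fun k : ℕ => (p k).toReal * powerGain α x k := by
  refine Summable.of_norm_bounded ((summable_dominating hpα).mul_left (x ^ α)) fun k => ?_
  rw [Real.norm_eq_abs, abs_mul, abs_of_nonneg ENNReal.toReal_nonneg]
  calc (p k).toReal * |powerGain α x k| ≤ (p k).toReal * (x ^ α * ((k : ℝ) ^ α + α)) := by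
        gcongr
        exact abs_powerGain_le hα hx (Nat.cast_nonneg k)
    _ = _ := by ring

theorem tsum_ofReal_gain_le (hα : 1 ≤ α)
    (hpα : Summable fun n : ℕ => (n : ℝ) ^ α * (p n).toReal) {x : ℝ} (hx : 1 ≤ x)
    {d : ℕ → ℝ} (hd : ∀ k, d k ≤ (p k).toReal * |powerGain α x k|) :
    ∑' k, ENNReal.ofReal (d k) ≤ (gainBound p α).toNNReal * ENNReal.ofReal (x ^ α) := by
  have h0 : ∀ k : ℕ, 0 ≤ (p k).toReal * ((k : ℝ) ^ α + α) := fun k =>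
    mul_nonneg ENNReal.toReal_nonneg (by positivity)
  calc ∑' k, ENNReal.ofReal (d k)
      ≤ ∑' k : ℕ, ENNReal.ofReal ((p k).toReal * ((k : ℝ) ^ α + α)) * ENNReal.ofReal (x ^ α) := by
        refine ENNReal.tsum_le_tsum fun k => ?_
        rw [← ENNReal.ofReal_mul (h0 k)]
        refine ENNReal.ofReal_le_ofReal ((hd k).trans ?_)
        calc (p k).toReal * |powerGain α x k| ≤ (p k).toReal * (x ^ α * ((k : ℝ) ^ α + α)) := by
              gcongr
              exact abs_powerGain_le hα hx (Nat.cast_nonneg k)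
          _ = _ := by ring
    _ = _ := by
        rw [ENNReal.tsum_mul_right, ← ENNReal.ofReal_tsum_of_nonneg h0 (summable_dominating hpα)]
        rfl

theorem toReal_tsum_sub_toReal_tsum {d : ℕ → ℝ} (hd : Summable d) :
    (∑' k, ENNReal.ofReal (d k)).toReal - (∑' k, ENNReal.ofReal (-d k)).toReal = ∑' k, d k := by
  rw [ENNReal.tsum_toReal_eq fun _ => ENNReal.ofReal_ne_top,
    ENNReal.tsum_toReal_eq fun _ => ENNReal.ofReal_ne_top]
  simp only [ENNReal.toReal_ofReal']
  rw [← Summable.tsum_sub]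
  · refine tsum_congr fun k => ?_
    rcases le_total 0 (d k) with h | h
    · rw [max_eq_left h, max_eq_right (by linarith)]; ring
    · rw [max_eq_right h, max_eq_left (by linarith)]; ring
  · refine Summable.of_norm_bounded hd.norm fun k => ?_
    rw [Real.norm_eq_abs, Real.norm_eq_abs, abs_of_nonneg (le_max_right _ _)]
    exact max_le (le_abs_self _) (abs_nonneg _)
  · refine Summable.of_norm_bounded hd.norm fun k => ?_
    rw [Real.norm_eq_abs, Real.norm_eq_abs, abs_of_nonneg (le_max_right _ _)]
    exact max_le (neg_le_abs _) (abs_nonneg _)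

/-- The generator applied to `x ^ α` is asymptotically `- α (1 - m) x ^ α`. -/
theorem eventually_generator_le (hα : 1 ≤ α)
    (hm : HasSum (fun n : ℕ => (n : ℝ) * (p n).toReal) m)
    (hpα : Summable fun n : ℕ => (n : ℝ) ^ α * (p n).toReal) {l : ℝ} (hl : l < α * (1 - m)) :
    ∀ᶠ x : ℕ in Filter.atTop, ∑' k : ℕ, (p k).toReal * powerGain α x k ≤ -l * (x : ℝ) ^ α := by
  have hlim : Filter.Tendsto (fun x : ℕ => ∑' k : ℕ, (p k).toReal *
      ((x : ℝ) * ((1 + ((k : ℝ) - 1) / x) ^ α - 1))) Filter.atTop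
      (𝓝 (∑' k : ℕ, (p k).toReal * (α * ((k : ℝ) - 1)))) := by
    refine tendsto_tsum_of_dominated_convergence (summable_dominating hpα)
      (fun k => (tendsto_relative_gain hα (k : ℝ)).const_mul _) ?_
    filter_upwards [Filter.eventually_ge_atTop 1] with x hx k
    have hx1 : (1 : ℝ) ≤ x := by exact_mod_cast hx
    obtain ⟨h1, h2⟩ := relative_gain_bounds hα hx1 (Nat.cast_nonneg k)
    have hk' : 0 ≤ (k : ℝ) ^ α := Real.rpow_nonneg (Nat.cast_nonneg k) α
    have hk : (0 : ℝ) ≤ k := Nat.cast_nonneg k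
    rw [Real.norm_eq_abs, abs_mul, abs_of_nonneg ENNReal.toReal_nonneg]
    refine mul_le_mul_of_nonneg_left (abs_le.2 ⟨?_, by linarith⟩) ENNReal.toReal_nonneg
    nlinarith
  have hval : ∑' k : ℕ, (p k).toReal * (α * ((k : ℝ) - 1)) = -(α * (1 - m)) := by
    have := ((hm.sub (hasSum_toReal p)).mul_left α).tsum_eq
    rw [show -(α * (1 - m)) = α * (m - 1) by ring, ← this]
    exact tsum_congr fun k => by ring
  rw [hval] at hlim
  filter_upwards [hlim.eventually_lt_const (show -(α * (1 - m)) < -l by linarith),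
    Filter.eventually_ge_atTop 1] with x hx hx1
  have hx1' : (1 : ℝ) ≤ x := by exact_mod_cast hx1
  have : ∑' k : ℕ, (p k).toReal * powerGain α x k = (x : ℝ) ^ α * ∑' k : ℕ, (p k).toReal *
      ((x : ℝ) * ((1 + ((k : ℝ) - 1) / x) ^ α - 1)) := by
    rw [← tsum_mul_left]
    refine tsum_congr fun k => ?_
    rw [powerGain_eq hx1' (Nat.cast_nonneg k)]
    ring
  rw [this, mul_comm (-l)]
  exact mul_le_mul_of_nonneg_left hx.le (by positivity)

end Reproduction

/-! ### Galton-Watson rates -/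

section GaltonWatsonRates

variable (p : PMF ℕ)

theorem tsum_gwRate_mul {x : ℕ} (hx : 1 ≤ x) (G : ℕ → ℝ≥0∞) :
    ∑' y, gwRate p x y * G y = ∑' k, (x : ℝ≥0∞) * p k * G (x + k - 1) := by
  have hinj : Function.Injective fun k : ℕ => x + k - 1 := fun a b h => by
    simp only at h; omega
  rw [← hinj.tsum_eq]
  · refine tsum_congr fun k => ?_
    have h1 : x ≤ x + k - 1 + 1 := by omega
    have h2 : x + k - 1 + 1 - x = k := by omega
    simp only [gwRate, hx, h1, and_self, if_true, h2]
  · intro y hy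
    have : 1 ≤ x ∧ x ≤ y + 1 := by
      by_contra h
      exact hy (by simp [gwRate, h])
    exact ⟨y + 1 - x, by simp only; omega⟩

theorem gwRate_zero_left (y : ℕ) : gwRate p 0 y = 0 := by simp [gwRate]

theorem gwRate_zero_right (x : ℕ) : gwRate p x 0 = if x = 1 then p 0 else 0 := by
  unfold gwRate
  by_cases h : x = 1
  · simp [h]
  · rw [if_neg h, if_neg]
    omega

theorem totalRate_gwRate (x : ℕ) : totalRate (gwRate p) x = x := by
  rcases Nat.eq_zero_or_pos x with rfl | hx
  · simp [totalRate, gwRate_zero_left]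
  · have := tsum_gwRate_mul p hx 1
    simp only [Pi.one_apply, mul_one] at this
    rw [totalRate, this, ENNReal.tsum_mul_left, p.tsum_coe, mul_one]

theorem tsum_gwUnkilledRate_add (x : ℕ+) (G : ℕ → ℝ≥0∞) :
    (∑' y : ℕ+, gwUnkilledRate p x y * G y) + gwRate p x 0 * G 0 = ∑' y, gwRate p x y * G y := by
  rw [tsum_eq_zero_add' (f := fun y => gwRate p x y * G y) ENNReal.summable, add_comm]
  congr 1
  exact tsum_pnat_eq_tsum_succ (f := fun y => gwRate p x y * G y)

theorem totalRate_gwUnkilledRate_add (x : ℕ+) :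
    totalRate (gwUnkilledRate p) x + gwRate p x 0 = (x : ℕ) := by
  have := tsum_gwUnkilledRate_add p x 1
  simp only [Pi.one_apply, mul_one] at this
  rw [totalRate, this]
  exact totalRate_gwRate p x

theorem gwRate_zero_right_ne_top (x : ℕ) : gwRate p x 0 ≠ ∞ := by
  rw [gwRate_zero_right]
  split_ifs
  exacts [p.apply_ne_top 0, ENNReal.zero_ne_top]

theorem totalRate_gwUnkilledRate_le (x : ℕ+) : totalRate (gwUnkilledRate p) x ≤ (x : ℕ) := by
  rw [← totalRate_gwUnkilledRate_add p x]
  exact le_self_add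

theorem totalRate_gwUnkilledRate_ne_top (x : ℕ+) : totalRate (gwUnkilledRate p) x ≠ ∞ :=
  ne_top_of_le_ne_top (ENNReal.natCast_ne_top _) (totalRate_gwUnkilledRate_le p x)

theorem totalRate_gwRate_ne_top (x : ℕ) : totalRate (gwRate p) x ≠ ∞ := by
  rw [totalRate_gwRate]; exact ENNReal.natCast_ne_top _

theorem gwKillingRate_le (x : ℕ+) : gwKillingRate p x ≤ (p 0).toNNReal := by
  unfold gwKillingRate
  refine ENNReal.toNNReal_mono (p.apply_ne_top 0) ?_
  rw [gwRate_zero_right]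
  split_ifs
  exacts [le_rfl, zero_le]

/-- Killing exactly compensates the jumps to `0` that are left out. -/
theorem eventRate_gwUnkilledRate (x : ℕ+) :
    eventRate (gwUnkilledRate p) (gwKillingRate p) x = eventRate (gwRate p) 0 (x : ℕ) := by
  have h1 := totalRate_gwUnkilledRate_add p x
  have h2 := ENNReal.toNNReal_add (totalRate_gwUnkilledRate_ne_top p x)
    (gwRate_zero_right_ne_top p x)
  rw [eventRate, eventRate, totalRate_gwRate, ← h1, h2, gwKillingRate]
  simp

/-- In the subcritical case `x + 1` is a Lyapunov function that also dominates the jump rate `x`. -/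
theorem mean_growth {m : ℝ} (hm : HasSum (fun n : ℕ => (n : ℝ) * (p n).toReal) m) (hm1 : m < 1)
    (x : ℕ) : ∑' y, gwRate p x y * ((y : ℝ≥0∞) + 1) ≤ x * ((x : ℝ≥0∞) + 1) := by
  rcases Nat.eq_zero_or_pos x with rfl | hx
  · simp [gwRate_zero_left]
  · have hmean : ∑' k : ℕ, p k * (k : ℝ≥0∞) ≤ 1 := by
      have h1 : ∀ k : ℕ, p k * (k : ℝ≥0∞) = ENNReal.ofReal ((k : ℝ) * (p k).toReal) := by
        intro k
        rw [ENNReal.ofReal_mul (Nat.cast_nonneg k), ENNReal.ofReal_toReal (p.apply_ne_top k),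
          ENNReal.ofReal_natCast, mul_comm]
      simp only [h1]
      rw [← ENNReal.ofReal_tsum_of_nonneg
        (fun k => mul_nonneg (Nat.cast_nonneg k) ENNReal.toReal_nonneg) hm.summable, hm.tsum_eq]
      exact ENNReal.ofReal_le_one.2 hm1.le
    rw [tsum_gwRate_mul p hx]
    calc ∑' k, (x : ℝ≥0∞) * p k * (((x + k - 1 : ℕ) : ℝ≥0∞) + 1)
        = ∑' k : ℕ, ((x : ℝ≥0∞) * x * p k + x * (p k * k)) := by
          refine tsum_congr fun k => ?_
          have : (((x + k - 1 : ℕ) : ℝ≥0∞) + 1) = x + k := by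
            have h : x + k - 1 + 1 = x + k := by omega
            exact_mod_cast congrArg (Nat.cast : ℕ → ℝ≥0∞) h
          rw [this]
          ring
      _ = (x : ℝ≥0∞) * x + x * ∑' k : ℕ, p k * k := by
          rw [ENNReal.tsum_add, ENNReal.tsum_mul_left, ENNReal.tsum_mul_left, p.tsum_coe, mul_one]
      _ ≤ (x : ℝ≥0∞) * x + x * 1 := by gcongr
      _ = _ := by ring

theorem nonExplosive_gwRate {m : ℝ} (hm : HasSum (fun n : ℕ => (n : ℝ) * (p n).toReal) m)
    (hm1 : m < 1) : NonExplosive (gwRate p) := by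
  refine nonExplosive_of_lyapunov (V := fun x => (x : ℝ≥0∞) + 1) (c := 0)
    (fun x => le_add_self) (fun x => by simp) (fun x => ?_) fun x => ?_
  · rw [totalRate_gwRate]; exact le_self_add
  · rw [totalRate_gwRate]
    simpa using mean_growth p hm hm1 x

theorem nonExplosive_gwUnkilledRate {m : ℝ}
    (hm : HasSum (fun n : ℕ => (n : ℝ) * (p n).toReal) m) (hm1 : m < 1) :
    NonExplosive (gwUnkilledRate p) := by
  refine nonExplosive_of_lyapunov (V := fun x => ((x : ℕ) : ℝ≥0∞) + 1) (c := 1)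
    (fun x => le_add_self) (fun x => by simp) (fun x => ?_) fun x => ?_
  · exact (totalRate_gwUnkilledRate_le p x).trans le_self_add
  · have h1 := tsum_gwUnkilledRate_add p x fun y => (y : ℝ≥0∞) + 1
    calc _ ≤ ∑' y, gwRate p x y * ((y : ℝ≥0∞) + 1) := by
          rw [← h1]; exact le_self_add
      _ ≤ (x : ℕ) * (((x : ℕ) : ℝ≥0∞) + 1) := mean_growth p hm hm1 x
      _ ≤ _ := by
          gcongr
          rw [← totalRate_gwUnkilledRate_add p x]
          gcongr
          rw [gwRate_zero_right]
          split_ifs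
          exacts [by simpa using p.coe_le_one 0, zero_le]

/-- Every positive state leads to every other one: down by deaths, up by births. -/
theorem gwUnkilledRate_reach (hp0 : 0 < p 0) (hp2 : 0 < p.toMeasure {n : ℕ | 2 ≤ n})
    {R : ℕ+ → ℕ+ → Prop} (hrefl : ∀ x, R x x)
    (hstep : ∀ x z y, gwUnkilledRate p x z ≠ 0 → R z y → R x y) (x y : ℕ+) : R x y := by
  obtain ⟨k, hk, hpk⟩ : ∃ k, 2 ≤ k ∧ p k ≠ 0 := by
    by_contra! h
    refine hp2.ne' ((PMF.toMeasure_apply_eq_zero_iff _ (Set.to_countable _).measurableSet).2 ?_)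
    rw [Set.disjoint_left]
    intro n hn hn2
    exact (PMF.mem_support_iff _ _).1 hn (h n hn2)
  have hdown : ∀ (d : ℕ) (x y : ℕ+), (x : ℕ) = y + d → R x y := by
    intro d
    induction d with
    | zero =>
      intro x y h
      obtain rfl : x = y := PNat.coe_injective h
      exact hrefl x
    | succ d ih =>
      intro x y h
      have hy : 1 ≤ (y : ℕ) := y.2
      obtain ⟨z, hz⟩ : ∃ z : ℕ+, (z : ℕ) = y + d := ⟨⟨y + d, by omega⟩, rfl⟩
      refine hstep x z y ?_ (ih _ _ hz)
      have h1 : 1 ≤ (x : ℕ) ∧ (x : ℕ) ≤ z + 1 := ⟨x.2, by omega⟩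
      have h2 : (z : ℕ) + 1 - x = 0 := by omega
      rw [gwUnkilledRate, gwRate, if_pos h1, h2]
      exact mul_ne_zero (by simp) hp0.ne'
  have hup : ∀ (d : ℕ) (x y : ℕ+), (y : ℕ) ≤ x + d → R x y := by
    intro d
    induction d with
    | zero => exact fun x y h => hdown (x - y) x y (by omega)
    | succ d ih =>
      intro x y h
      have hx : 1 ≤ (x : ℕ) := x.2
      obtain ⟨z, hz⟩ : ∃ z : ℕ+, (z : ℕ) = x + k - 1 := ⟨⟨x + k - 1, by omega⟩, rfl⟩
      refine hstep x z y ?_ (ih _ _ (by omega))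
      have h1 : 1 ≤ (x : ℕ) ∧ (x : ℕ) ≤ z + 1 := ⟨hx, by omega⟩
      have h2 : (z : ℕ) + 1 - x = k := by omega
      rw [gwUnkilledRate, gwRate, if_pos h1, h2]
      exact mul_ne_zero (by simp) hpk
  exact hup y x y (by omega)

end GaltonWatsonRates

/-! ### The killed process, small sets and survival -/

section GaltonWatson

variable (p : PMF ℕ)

/-- The killed process and the Galton-Watson process satisfy the same first-jump equation: the
parameters of the first event agree, and after absorption at `0` nothing is collected since
`f 0 = 0`. -/
theorem renewalIter_gwUnkilledRate (f : ℕ → ℝ≥0∞) (hf : f 0 = 0) (n : ℕ) (t : ℝ) (x : ℕ+) :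
    renewalIter (gwUnkilledRate p) (eventRate (gwUnkilledRate p) (gwKillingRate p))
      (fun x => f (x : ℕ)) 0 n t x =
    renewalIter (gwRate p) (eventRate (gwRate p) 0) f 0 n t (x : ℕ) := by
  have h0 : ∀ (n : ℕ) (t : ℝ), renewalIter (gwRate p) (eventRate (gwRate p) 0) f 0 n t 0 = 0 := by
    intro n t
    cases n with
    | zero => rfl
    | succ n => simp [renewalIter, jumpStep, gwRate_zero_left, hf]
  induction n generalizing t x with
  | zero => rfl
  | succ n ih =>
    simp only [renewalIter, jumpStep, eventRate_gwUnkilledRate]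
    congr 1
    refine lintegral_congr fun s => ?_
    congr 1
    rw [← tsum_gwUnkilledRate_add, h0, mul_zero, add_zero]
    exact tsum_congr fun y => by rw [ih]

theorem cemeteryToZero_mem_iff {B : Set ℕ} (hB : 0 ∉ B) (z : Option ℕ+) :
    cemeteryToZero z ∈ B ↔ ∃ y ∈ (fun y : ℕ+ => (y : ℕ)) ⁻¹' B, z = some y := by
  cases z with
  | none => simp [cemeteryToZero, hB]
  | some z => simp [cemeteryToZero]

variable {p} {m : ℝ}

theorem killedLaw_cemeteryToZero_mem (hm : HasSum (fun n : ℕ => (n : ℝ) * (p n).toReal) m)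
    (hm1 : m < 1) (x : ℕ+) {t : ℝ} (ht : 0 ≤ t) {B : Set ℕ} (hB : 0 ∉ B) :
    killedLaw (jumpLaw (gwUnkilledRate p)) x
      {ω | cemeteryToZero (killed (jumpProcess (gwUnkilledRate p)) (gwKillingRate p) t ω) ∈ B} =
    jumpLaw (gwRate p) (x : ℕ) {ω | jumpProcess (gwRate p) t ω ∈ B} := by
  simp only [cemeteryToZero_mem_iff hB]
  rw [(nonExplosive_gwUnkilledRate p hm hm1).killedLaw_mem_eq_iSup (gwKillingRate_le p)
    (totalRate_gwUnkilledRate_ne_top p) ht,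
    (nonExplosive_gwRate p hm hm1).measure_jumpProcess_mem (totalRate_gwRate_ne_top p) ht]
  refine iSup_congr fun n => ?_
  exact renewalIter_gwUnkilledRate p (B.indicator 1) (Set.indicator_of_notMem hB _) n t x

instance instIsProbabilityMeasureKilledLaw {E : Type*} [MeasurableSpace E]
    [MeasurableSingletonClass E] [Countable E] (q : E → E → ℝ≥0∞) (x : E) :
    IsProbabilityMeasure (killedLaw (jumpLaw q) x) := by
  unfold killedLaw; infer_instance

/-- The killed process is the Galton-Watson process. -/
theorem killedLaw_cemeteryToZero_eq (hm : HasSum (fun n : ℕ => (n : ℝ) * (p n).toReal) m)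
    (hm1 : m < 1) (x : ℕ+) {t : ℝ} (ht : 0 ≤ t) (y : ℕ) :
    killedLaw (jumpLaw (gwUnkilledRate p)) x
      {ω | cemeteryToZero (killed (jumpProcess (gwUnkilledRate p)) (gwKillingRate p) t ω) = y} =
    jumpLaw (gwRate p) (x : ℕ) {ω | jumpProcess (gwRate p) t ω = y} := by
  rcases eq_or_ne y 0 with rfl | hy
  · -- the mass at `0` is the complement of the mass on the positive states
    have h0 : (0 : ℕ) ∉ ({0}ᶜ : Set ℕ) := by simp
    have h := killedLaw_cemeteryToZero_mem hm hm1 x ht h0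
    have hm1 : MeasurableSet {ω | cemeteryToZero
        (killed (jumpProcess (gwUnkilledRate p)) (gwKillingRate p) t ω) ∈ ({0}ᶜ : Set ℕ)} := by
      simp only [cemeteryToZero_mem_iff h0]
      exact measurableSet_killed_mem _ _ _ _
    have hm2 : MeasurableSet {ω | jumpProcess (gwRate p) t ω ∈ ({0}ᶜ : Set ℕ)} :=
      (Set.to_countable _).measurableSet.preimage (measurable_jumpProcess (gwRate p) t)
    have hc1 := prob_compl_eq_one_sub (μ := killedLaw (jumpLaw (gwUnkilledRate p)) x) hm1
    have hc2 := prob_compl_eq_one_sub (μ := jumpLaw (gwRate p) (x : ℕ)) hm2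
    rw [h, ← hc2] at hc1
    convert hc1 using 2
    · ext ω; simp
    · ext ω; simp
  · exact killedLaw_cemeteryToZero_mem hm hm1 x ht (B := {y}) (by simpa using hy.symm)

/-- The positive states communicate, so each of them charges a fixed state `y` at time `1`, and the
minorizing measure is the Dirac mass at `y`. -/
theorem isSmallSet_gwUnkilledRate (hp0 : 0 < p 0) (hp2 : 0 < p.toMeasure {n : ℕ | 2 ≤ n})
    (hm : HasSum (fun n : ℕ => (n : ℝ) * (p n).toReal) m) (hm1 : m < 1) {K : Set ℕ+}
    (hK : K.Finite) (hne : K.Nonempty) :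
    IsSmallSet (jumpLaw (gwUnkilledRate p)) (jumpProcess (gwUnkilledRate p)) K := by
  obtain ⟨y, hy⟩ := hne
  set q := gwUnkilledRate p with hq
  have hmass : ∀ (t : ℝ), 0 ≤ t → ∀ x, jumpLaw q x {ω | jumpProcess q t ω ∈ ({y} : Set ℕ+)} =
      ⨆ n, renewalIter q (eventRate q 0) (({y} : Set ℕ+).indicator 1) 0 n t x := fun t ht x =>
    (nonExplosive_gwUnkilledRate p hm hm1).measure_jumpProcess_mem
      (totalRate_gwUnkilledRate_ne_top p) ht x _
  have hpos : ∀ x t, 0 < t →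
      0 < ⨆ n, renewalIter q (eventRate q 0) (({y} : Set ℕ+).indicator 1) 0 n t x := by
    intro x
    refine gwUnkilledRate_reach p hp0 hp2
      (R := fun x y => ∀ t : ℝ, 0 < t →
        0 < ⨆ n, renewalIter q (eventRate q 0) (({y} : Set ℕ+).indicator 1) 0 n t x) ?_ ?_ x y
    · intro x t _
      refine lt_of_lt_of_le ?_ (exp_mul_le_iSup_renewalIter x t)
      simp [Real.exp_pos]
    · intro x z y hxz hz t ht
      exact iSup_renewalIter_pos_of_rate hxz hz ht
  have hpos1 : ∀ x, 0 < jumpLaw q x {ω | jumpProcess q 1 ω ∈ ({y} : Set ℕ+)} := fun x => by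
    rw [hmass 1 zero_le_one]; exact hpos x 1 one_pos
  obtain ⟨x₀, _, hx₀⟩ := K.exists_min_image
    (fun x => jumpLaw q x {ω | jumpProcess q 1 ω ∈ ({y} : Set ℕ+)}) hK ⟨y, hy⟩
  set a := jumpLaw q x₀ {ω | jumpProcess q 1 ω ∈ ({y} : Set ℕ+)} with ha
  have hatop : a ≠ ∞ := measure_ne_top _ _
  refine ⟨1, one_pos, a.toReal, ENNReal.toReal_pos (hpos1 x₀).ne' hatop, Measure.dirac y,
    inferInstance, ?_, fun x hx A hA => ?_⟩
  · rw [Measure.dirac_apply' _ (Set.to_countable _).measurableSet]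
    simp [hy]
  · rw [ENNReal.ofReal_toReal hatop, Measure.dirac_apply' _ (Set.to_countable _).measurableSet]
    by_cases hyA : y ∈ A
    · rw [Set.indicator_of_mem (show y ∈ A ∩ K from ⟨hyA, hy⟩), Pi.one_apply, mul_one]
      refine (hx₀ x hx).trans (measure_mono fun ω hω => ?_)
      have h : jumpProcess q 1 ω = y := hω
      exact (by rw [h]; exact hyA : jumpProcess q 1 ω ∈ A)
    · rw [Set.indicator_of_notMem fun h => hyA h.1, mul_zero]
      exact zero_le

theorem survivalProb_antitone {Ω E : Type*} [MeasurableSpace Ω] [MeasurableSpace E]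
    (P : E → Measure Ω) (X : ℝ → Ω → E) (κ : E → ℝ≥0) (x : E) :
    Antitone fun t => survivalProb P X κ t x := by
  intro s t hst
  refine measure_mono fun ω hω => ?_
  have h : killed X κ t ω ≠ none := hω
  have h' : killed X κ s ω ≠ none := by
    unfold killed at h ⊢
    split_ifs at h with h1
    · rw [if_pos (lt_of_le_of_lt (lintegral_mono_set (Set.Ioc_subset_Ioc_right hst)) h1)]
      simp
    · exact absurd rfl h
  exact h'

theorem survivalProb_eq_iSup (hm : HasSum (fun n : ℕ => (n : ℝ) * (p n).toReal) m)
    (hm1 : m < 1) {t : ℝ} (ht : 0 ≤ t) (x : ℕ+) :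
    survivalProb (jumpLaw (gwUnkilledRate p)) (jumpProcess (gwUnkilledRate p))
      (gwKillingRate p) t x =
    ⨆ n, renewalIter (gwUnkilledRate p) (eventRate (gwUnkilledRate p) (gwKillingRate p)) 1 0 n t
      x := by
  have h := (nonExplosive_gwUnkilledRate p hm hm1).killedLaw_mem_eq_iSup (gwKillingRate_le p)
    (totalRate_gwUnkilledRate_ne_top p) ht x Set.univ
  rw [Set.indicator_univ] at h
  rw [← h, survivalProb]
  congr 1
  ext ω
  simp [Option.ne_none_iff_exists']

/-- Survival probabilities from different starting points are comparable uniformly in time: this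
holds for two states joined by a jump, and the positive states communicate. -/
theorem survivalProb_comparison (hp0 : 0 < p 0) (hp2 : 0 < p.toMeasure {n : ℕ | 2 ≤ n})
    (hm : HasSum (fun n : ℕ => (n : ℝ) * (p n).toReal) m) (hm1 : m < 1) (x y : ℕ+) :
    ∃ c : ℝ≥0∞, 0 < c ∧ ∀ t, 0 ≤ t →
      c * survivalProb (jumpLaw (gwUnkilledRate p)) (jumpProcess (gwUnkilledRate p))
        (gwKillingRate p) t y ≤
      survivalProb (jumpLaw (gwUnkilledRate p)) (jumpProcess (gwUnkilledRate p))
        (gwKillingRate p) t x := by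
  set q := gwUnkilledRate p with hq
  set κ := gwKillingRate p with hκ
  have hS := fun {t : ℝ} (ht : 0 ≤ t) x => survivalProb_eq_iSup hm hm1 ht x
  refine gwUnkilledRate_reach p hp0 hp2 (R := fun x y => ∃ c : ℝ≥0∞, 0 < c ∧ ∀ t, 0 ≤ t →
      c * survivalProb (jumpLaw q) (jumpProcess q) κ t y ≤
        survivalProb (jumpLaw q) (jumpProcess q) κ t x) ?_ ?_ x y
  · exact fun x => ⟨1, one_pos, fun t _ => by rw [one_mul]⟩
  · rintro x z y hxz ⟨c, hc, h⟩
    obtain ⟨d, hd, h'⟩ := iSup_renewalIter_comparison (r := eventRate q κ) (f := 1) (x := x)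
      (z := z) rfl hxz (fun s t hs hst => by
        rw [← hS (hs.trans hst), ← hS hs]
        exact survivalProb_antitone _ _ _ _ hst) (fun t ht => by
        rw [← hS ht]
        exact prob_le_one)
    refine ⟨d * c, pos_of_ne_zero (mul_ne_zero hd.ne' hc.ne'), fun t ht => ?_⟩
    rw [mul_assoc]
    refine (mul_le_mul_right (h t ht) d).trans ?_
    rw [hS ht, hS ht]
    exact h' t ht

theorem survival_ratio_pos (hp0 : 0 < p 0) (hp2 : 0 < p.toMeasure {n : ℕ | 2 ≤ n})
    (hm : HasSum (fun n : ℕ => (n : ℝ) * (p n).toReal) m) (hm1 : m < 1) {K : Set ℕ+}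
    (hK : K.Finite) (hne : K.Nonempty) :
    0 < ⨅ t : {t : ℝ // 0 ≤ t},
      (⨅ x : K, survivalProb (jumpLaw (gwUnkilledRate p)) (jumpProcess (gwUnkilledRate p))
        (gwKillingRate p) t x) /
      (⨆ x : K, survivalProb (jumpLaw (gwUnkilledRate p)) (jumpProcess (gwUnkilledRate p))
        (gwKillingRate p) t x) := by
  set S := survivalProb (jumpLaw (gwUnkilledRate p)) (jumpProcess (gwUnkilledRate p))
    (gwKillingRate p) with hSdef
  choose c hc0 hc using fun x y => survivalProb_comparison hp0 hp2 hm hm1 x y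
  obtain ⟨z, _, hz⟩ := (K ×ˢ K).exists_min_image (fun z => c z.1 z.2) (hK.prod hK)
    (hne.prod hne)
  refine lt_of_lt_of_le (hc0 z.1 z.2) (le_iInf fun t => ?_)
  obtain ⟨x₀, hx₀⟩ := hne
  have hpos : (⨆ x : K, S t x) ≠ 0 := by
    refine (lt_of_lt_of_le ?_ (le_iSup (fun x : K => S t x) ⟨x₀, hx₀⟩)).ne'
    rw [hSdef, survivalProb_eq_iSup hm hm1 t.2]
    refine lt_of_lt_of_le ?_ (exp_mul_le_iSup_renewalIter _ _)
    simp [Real.exp_pos]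
  have htop : (⨆ x : K, S t x) ≠ ∞ := ne_top_of_le_ne_top ENNReal.one_ne_top
    (iSup_le fun x => prob_le_one)
  rw [ENNReal.le_div_iff_mul_le (Or.inl hpos) (Or.inl htop)]
  refine le_iInf fun x => ?_
  rw [ENNReal.mul_iSup]
  refine iSup_le fun y => ?_
  exact (mul_le_mul_left (hz (x, y) ⟨x.2, y.2⟩) _).trans (hc x y t t.2)

end GaltonWatson

/-! ### The Lyapunov condition -/

section Drift

variable {p : PMF ℕ} {m α : ℝ}

/-- A rate multiplied by a positive part of a difference of powers, for reproduction events. -/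
theorem rate_mul_ofReal_sub (p : PMF ℕ) (k : ℕ) {x : ℕ} (u v : ℝ) (hv : 0 ≤ v) :
    (x : ℝ≥0∞) * p k * (ENNReal.ofReal u - ENNReal.ofReal v) =
      ENNReal.ofReal ((p k).toReal * (x * (u - v))) := by
  rw [← ENNReal.ofReal_sub _ hv, ENNReal.ofReal_mul ENNReal.toReal_nonneg,
    ENNReal.ofReal_toReal (p.apply_ne_top k), ENNReal.ofReal_mul (Nat.cast_nonneg x),
    ENNReal.ofReal_natCast]
  ring

theorem tsum_gwRate_increase (α : ℝ) {x : ℕ} (hx : 1 ≤ x) :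
    ∑' y : ℕ, gwRate p x y * (ENNReal.ofReal ((y : ℝ) ^ α) - ENNReal.ofReal ((x : ℝ) ^ α)) =
      ∑' k : ℕ, ENNReal.ofReal ((p k).toReal * powerGain α x k) := by
  rw [tsum_gwRate_mul p hx fun y : ℕ => ENNReal.ofReal ((y : ℝ) ^ α) - ENNReal.ofReal ((x : ℝ) ^ α)]
  refine tsum_congr fun k => ?_
  rw [rate_mul_ofReal_sub p k _ _ (by positivity), powerGain]
  have h : ((x + k - 1 : ℕ) : ℝ) = x + k - 1 := by
    rw [Nat.cast_sub (by omega)]; push_cast; ring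
  rw [h]

theorem tsum_gwRate_decrease (α : ℝ) {x : ℕ} (hx : 1 ≤ x) :
    ∑' y : ℕ, gwRate p x y * (ENNReal.ofReal ((x : ℝ) ^ α) - ENNReal.ofReal ((y : ℝ) ^ α)) =
      ∑' k : ℕ, ENNReal.ofReal (-((p k).toReal * powerGain α x k)) := by
  rw [tsum_gwRate_mul p hx fun y : ℕ => ENNReal.ofReal ((x : ℝ) ^ α) - ENNReal.ofReal ((y : ℝ) ^ α)]
  refine tsum_congr fun k => ?_
  rw [rate_mul_ofReal_sub p k _ _ (by positivity), powerGain]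
  have h : ((x + k - 1 : ℕ) : ℝ) = x + k - 1 := by
    rw [Nat.cast_sub (by omega)]; push_cast; ring
  rw [h]
  congr 1
  ring

theorem tsum_gwUnkilledRate_le (x : ℕ+) (G : ℕ → ℝ≥0∞) :
    ∑' y : ℕ+, gwUnkilledRate p x y * G y ≤ ∑' y, gwRate p x y * G y := by
  rw [← tsum_gwUnkilledRate_add p x G]
  exact le_self_add

theorem tsum_gwUnkilledRate_eq {x : ℕ+} (hx : 2 ≤ (x : ℕ)) (G : ℕ → ℝ≥0∞) :
    ∑' y : ℕ+, gwUnkilledRate p x y * G y = ∑' y, gwRate p x y * G y := by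
  rw [← tsum_gwUnkilledRate_add p x G, gwRate_zero_right, if_neg (by omega), zero_mul, add_zero]

theorem drift_gwUnkilledRate (hα : 1 ≤ α)
    (hm : HasSum (fun n : ℕ => (n : ℝ) * (p n).toReal) m) (hm1 : m < 1)
    (hpα : Summable fun n : ℕ => (n : ℝ) ^ α * (p n).toReal) {l : ℝ} (hl : l < α * (1 - m)) :
    ∃ LV : ℕ+ → ℝ, IsExtendedGenerator (jumpLaw (gwUnkilledRate p))
      (jumpProcess (gwUnkilledRate p)) (fun x : ℕ+ => ((x : ℕ) : ℝ) ^ α) LV ∧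
      ∃ C : ℝ, ∀ x : ℕ+, LV x ≤ -l * ((x : ℕ) : ℝ) ^ α + C := by
  have hx1 : ∀ x : ℕ+, (1 : ℝ) ≤ ((x : ℕ) : ℝ) := fun x => by exact_mod_cast x.2
  have hgen := (nonExplosive_gwUnkilledRate p hm hm1).isExtendedGenerator
    (totalRate_gwUnkilledRate_ne_top p) (V := fun x : ℕ+ => ((x : ℕ) : ℝ) ^ α)
    (fun x => by positivity) (C := (gainBound p α).toNNReal)
    (fun x => by
      refine (tsum_gwUnkilledRate_le x fun y : ℕ =>
        ENNReal.ofReal (((x : ℕ) : ℝ) ^ α) - ENNReal.ofReal ((y : ℝ) ^ α)).trans ?_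
      rw [tsum_gwRate_decrease α (show 1 ≤ (x : ℕ) from x.pos)]
      refine tsum_ofReal_gain_le hα hpα (hx1 x) fun k => ?_
      rw [← mul_neg]
      exact mul_le_mul_of_nonneg_left (neg_le_abs _) ENNReal.toReal_nonneg)
    (fun x => by
      refine (tsum_gwUnkilledRate_le x fun y : ℕ =>
        ENNReal.ofReal ((y : ℝ) ^ α) - ENNReal.ofReal (((x : ℕ) : ℝ) ^ α)).trans ?_
      rw [tsum_gwRate_increase α (show 1 ≤ (x : ℕ) from x.pos)]
      refine tsum_ofReal_gain_le hα hpα (hx1 x) fun k => ?_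
      exact mul_le_mul_of_nonneg_left (le_abs_self _) ENNReal.toReal_nonneg)
  refine ⟨_, hgen, ?_⟩
  set LV : ℕ+ → ℝ := fun x =>
    (∑' y : ℕ+, gwUnkilledRate p x y * (ENNReal.ofReal (((y : ℕ) : ℝ) ^ α) -
      ENNReal.ofReal (((x : ℕ) : ℝ) ^ α))).toReal -
    (∑' y : ℕ+, gwUnkilledRate p x y * (ENNReal.ofReal (((x : ℕ) : ℝ) ^ α) -
      ENNReal.ofReal (((y : ℕ) : ℝ) ^ α))).toReal with hLV
  have hLVx : ∀ x : ℕ+, 2 ≤ (x : ℕ) →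
      LV x = ∑' k : ℕ, (p k).toReal * powerGain α (x : ℕ) k := by
    intro x hx
    rw [hLV]
    simp only
    rw [tsum_gwUnkilledRate_eq hx fun y : ℕ =>
        ENNReal.ofReal ((y : ℝ) ^ α) - ENNReal.ofReal (((x : ℕ) : ℝ) ^ α),
      tsum_gwUnkilledRate_eq hx fun y : ℕ =>
        ENNReal.ofReal (((x : ℕ) : ℝ) ^ α) - ENNReal.ofReal ((y : ℝ) ^ α),
      tsum_gwRate_increase α (show 1 ≤ (x : ℕ) from x.pos),
      tsum_gwRate_decrease α (show 1 ≤ (x : ℕ) from x.pos)]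
    exact toReal_tsum_sub_toReal_tsum (summable_powerGain hα hpα (hx1 x))
  obtain ⟨N, hN⟩ := Filter.eventually_atTop.1 (eventually_generator_le hα hm hpα hl)
  -- the finitely many states below the threshold are absorbed in the constant
  have hfin : {x : ℕ+ | (x : ℕ) ≤ max N 2}.Finite :=
    (Set.finite_Iic (max N 2)).preimage PNat.coe_injective.injOn
  obtain ⟨C, hC⟩ := (hfin.image fun x : ℕ+ => LV x + l * ((x : ℕ) : ℝ) ^ α).bddAbove
  refine ⟨max C 0, fun x => ?_⟩
  rcases le_or_gt (x : ℕ) (max N 2) with hx | hx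
  · have h1 := hC ⟨x, hx, rfl⟩
    simp only at h1
    have h2 := le_max_left C 0
    change LV x ≤ _
    linarith
  · have h1 := hN x ((le_max_left N 2).trans hx.le)
    rw [← hLVx x ((le_max_right N 2).trans hx.le)] at h1
    have h2 := le_max_right C 0
    change LV x ≤ _
    linarith

end Drift

theorem mainTheorem6 (p : PMF ℕ) (hp0 : 0 < p 0) (hp2 : 0 < p.toMeasure {n : ℕ | 2 ≤ n})
    (m : ℝ) (hm : HasSum (fun n : ℕ => (n : ℝ) * (p n).toReal) m) (hm0 : 0 < m) (hm1 : m < 1)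
    (α : ℝ) (hα : (p 0).toReal / (1 - m) < α)
    (hpα : Summable fun n : ℕ => (n : ℝ) ^ α * (p n).toReal) :
    (∀ (x : ℕ+) (t : ℝ), 0 ≤ t → ∀ y : ℕ,
      killedLaw (jumpLaw (gwUnkilledRate p)) x
          {ω | cemeteryToZero (killed (jumpProcess (gwUnkilledRate p)) (gwKillingRate p) t ω) = y}
        = jumpLaw (gwRate p) (x : ℕ) {ω | jumpProcess (gwRate p) t ω = y}) ∧
    AssumptionH (jumpLaw (gwUnkilledRate p)) (jumpProcess (gwUnkilledRate p)) (gwKillingRate p)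
      (fun x : ℕ+ => ((x : ℕ) : ℝ) ^ α) := by
  have h1m : 0 < 1 - m := sub_pos.2 hm1
  -- since `1 - m ≤ p 0`, the hypothesis on `α` forces `α > 1`
  have hα1 : 1 ≤ α := ((one_le_div h1m).2 (one_sub_mean_le hm)).trans hα.le
  have hx1 : ∀ x : ℕ+, (1 : ℝ) ≤ ((x : ℕ) : ℝ) := fun x => by exact_mod_cast x.2
  refine ⟨fun x t ht y => killedLaw_cemeteryToZero_eq hm hm1 x ht y, ?_⟩
  refine
    { measurable_rate := measurable_of_countable _
      bounded_rate := ⟨(p 0).toNNReal, by rintro _ ⟨x, rfl⟩; exact gwKillingRate_le p x⟩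
      small := fun K hK hne =>
        isSmallSet_gwUnkilledRate hp0 hp2 hm hm1 (isCompact_iff_finite.1 hK) hne
      one_le := fun x => Real.one_le_rpow (hx1 x) (by linarith)
      locally_bounded := fun x => ⟨{x}, by simp, by simp⟩
      level_sets := fun r => ?_
      drift := ?_
      survival := fun K hK hne =>
        survival_ratio_pos hp0 hp2 hm hm1 (isCompact_iff_finite.1 hK) hne }
  · have hfin : {x : ℕ+ | ((x : ℕ) : ℝ) ^ α ≤ r}.Finite := by
      refine ((Set.finite_Iic ⌊r⌋₊).preimage PNat.coe_injective.injOn).subset fun x hx => ?_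
      have h : ((x : ℕ) : ℝ) ≤ r := (Real.self_le_rpow_of_one_le (hx1 x) hα1).trans hx
      exact Nat.le_floor h
    rw [closure_discrete]
    exact hfin.isCompact
  · obtain ⟨l, hl0, hl1⟩ := exists_between ((div_lt_iff₀ h1m).1 hα)
    obtain ⟨LV, hLV, C, hC⟩ := drift_gwUnkilledRate hα1 hm hm1 hpα hl1
    refine ⟨LV, hLV, l, C, lt_of_le_of_lt ?_ hl0, hC⟩
    have h : (⨆ x, gwKillingRate p x) ≤ (p 0).toNNReal := ciSup_le (gwKillingRate_le p)
    exact_mod_cast h
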